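/- Let $A=(A_{ij})_{i,j\in I}$ be a generalized Cartan matrix with finite index set $I$ that is simply laced (all off-diagonal entries are $0$ or $-1$) and hyperbolic (its Dynkin diagram is irreducible and of neither finite nor affine type, but every proper irreducible subdiagram is of finite or affine type). Let $\Lambda=\bigoplus_{i\in I}\mathbb Z\alpha_i$ be the root lattice with the symmetric bilinear form $\alpha_i\cdot\alpha_j=A_{ij}$, let $W$ be the Weyl group, generated by the reflections $x\mapsto x-(x\cdot\alpha_i)\alpha_i$, let $\Phi=\bigcup_i W\alpha_i$ be the set of real roots, and let $\Phi_+$ (resp. $\Phi_-$) be the set of real roots whose coordinates in the $\alpha_i$ are all $\ge 0$ (resp. all $\le 0$). Real roots $\alpha,\beta$ form a *prenilpotent pair* if there are $w,w'\in W$ with $w\alpha,w\beta\in\Phi_+$ and $w'\alpha,w'\beta\in\Phi_-$. Let $\mathfrak g$ be the complex Lie algebra with Chevalley generators $e_i,f_i,h_i$ and the Serre relations of $A$, and let $s_i^*=\exp(\operatorname{ad}e_i)\exp(-\operatorname{ad}f_i)\exp(\operatorname{ad}e_i)$. For every $\alpha\in\Phi$ choose a vector $e_\alpha$ in the double basis of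 the root space $\mathfrak g_\alpha$, i.e. $e_\alpha=\pm s_{i_1}^*\cdots s_{i_k}^*(e_j)$ for some $i_1,\dots,i_k,j$ such that the product of the corresponding reflections takes $\alpha_j$ to $\alpha$. For a commutative ring $R$ let $X_\alpha:R\to U_\alpha$ ($\alpha\in\Phi$) be isomorphisms from the additive group of $R$ to copies $U_\alpha$ of it. The *Chevalley relation* of a prenilpotent pair $\alpha,\beta$ at $t,u\in R$ is $$[X_\alpha(t),X_\beta(u)]=\prod_{\gamma=m\alpha+n\beta}X_\gamma\bigl(c_\gamma t^m u^n\bigr)$$ in the free product of the groups $U_\gamma$, where $\gamma$ runs, in some order, over the real roots in $(\mathbb N\alpha+\mathbb N\beta)\setminus\{\alpha,\beta\}$, and the integers $c_\gamma$ are such that $$\exp(te_\alpha)\exp(ue_\beta)\exp(-te_\alpha)\exp(-ue_\beta)=\prod_{\gamma=m\alpha+n\beta}\exp\bigl(c_\gamma t^mu^ne_\gamma\bigr)$$ as formal power series in commuting variables $t,u$ over the enveloping algebra of $\mathfrak g$, with the product in the same order. The Steinberg group $\mathrm{St}_A(R)$ is the quotient of the free product of the $U_\alpha$ by the Chevalley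 relations of all prenilpotent pairs. Let $\alpha\neq\beta$ be real roots. Then $\alpha,\beta$ form a prenilpotent pair if and only if $\alpha\cdot\beta\ge-1$. Suppose that they do. 1. If $\alpha\cdot\beta=-1$, then $\alpha+\beta$ is a real root and there is a sign $\varepsilon\in\{1,-1\}$, not depending on $R$, $t$, $u$, such that for every commutative ring $R$ and all $t,u\in R$ the right side of the Chevalley relation is precisely $X_{\alpha+\beta}(\varepsilon tu)$; that is, the relation is $[X_\alpha(t),X_\beta(u)]=X_{\alpha+\beta}(\varepsilon tu)$. 2. If $\alpha\cdot\beta\ne-1$, then for every commutative ring $R$ and all $t,u\in R$ the right side of the Chevalley relation is precisely $1$; that is, the relation is $[X_\alpha(t),X_\beta(u)]=1$. In particular these identities hold in $\mathrm{St}_A(R)$. -/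

import Mathlib

open scoped Matrix commutatorElement

noncomputable section

namespace KacMoody

universe u v

/-! ## Generalized Cartan matrices and their types -/

section Types

variable {I : Type u}

/-- Generalized Cartan matrices (Dynkin diagrams are identified with these). -/
structure IsGCM (A : Matrix I I ℤ) : Prop where
  diag : ∀ i, A i i = 2
  off_diag : ∀ i j, i ≠ j → A i j ≤ 0
  zero_symm : ∀ i j, A i j = 0 → A j i = 0

/-- The graph underlying the Dynkin diagram: distinct nodes are joined when `A i j ≠ 0`
or `A j i ≠ 0` (for a generalized Cartan matrix the two conditions agree). -/
def dynkinGraph (A : Matrix I I ℤ) : SimpleGraph I where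
  Adj i j := i ≠ j ∧ (A i j ≠ 0 ∨ A j i ≠ 0)
  symm := ⟨fun _ _ h => ⟨h.1.symm, h.2.symm⟩⟩
  loopless := ⟨fun _ h => h.1 rfl⟩

/-- The diagram is irreducible: nonempty and connected. -/
def IsIrreducible (A : Matrix I I ℤ) : Prop :=
  (dynkinGraph A).Connected

/-- The matrix of the full subdiagram with node set `s`. -/
def subdiagram (A : Matrix I I ℤ) (s : Set I) : Matrix s s ℤ :=
  A.submatrix (fun i => (i : I)) (fun i => (i : I))

variable [DecidableEq I]

/-- The matrix obtained from `A` by scaling the rows by the numbers `d i`. -/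
def rowScaled (A : Matrix I I ℤ) (d : I → ℝ) : Matrix I I ℝ :=
  Matrix.of fun i j => d i * (A i j : ℝ)

/-- Finite type (for irreducible diagrams): `A` has a positive definite symmetrization. -/
def IsFiniteType (A : Matrix I I ℤ) : Prop :=
  ∃ d : I → ℝ, (∀ i, 0 < d i) ∧ (rowScaled A d).PosDef

/-- Affine type (for irreducible diagrams): `A` has a symmetrization that is positive
semidefinite but not positive definite. -/
def IsAffineType (A : Matrix I I ℤ) : Prop :=
  ∃ d : I → ℝ, (∀ i, 0 < d i) ∧ (rowScaled A d).PosSemidef ∧ ¬ (rowScaled A d).PosDef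

/-- An irreducible diagram is hyperbolic if it is of neither finite nor affine type, but all its
proper irreducible subdiagrams are of finite or affine type. -/
def IsHyperbolic (A : Matrix I I ℤ) : Prop :=
  IsIrreducible A ∧ ¬ IsFiniteType A ∧ ¬ IsAffineType A ∧
    ∀ s : Set I, s ≠ Set.univ → IsIrreducible (subdiagram A s) →
      IsFiniteType (subdiagram A s) ∨ IsAffineType (subdiagram A s)

end Types

/-! ## Root lattice, Weyl group, real roots (`A` symmetric) -/

variable {I : Type u} [Fintype I] [DecidableEq I] (A : Matrix I I ℤ)

/-- The inner product on the root lattice `I → ℤ` with Gram matrix `A` on the simple roots. -/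
def dot (x y : I → ℤ) : ℤ := x ⬝ᵥ (A *ᵥ y)

/-- The simple root `α_i`, a basis vector of the root lattice. -/
def simpleRoot (i : I) : I → ℤ := Pi.single i 1

/-- The reflection in the simple root `α_i` (which has norm `2`). -/
def simpleReflection (i : I) (x : I → ℤ) : I → ℤ :=
  x - dot A x (simpleRoot i) • simpleRoot i

/-- The Weyl group: the group of lattice automorphisms generated by the simple reflections. -/
def weylGroup : Subgroup ((I → ℤ) ≃ₗ[ℤ] (I → ℤ)) :=
  Subgroup.closure {g | ∃ i, ∀ x, g x = simpleReflection A i x}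

/-- The real roots: the Weyl group images of the simple roots. -/
def realRoots : Set (I → ℤ) :=
  {x | ∃ w ∈ weylGroup A, ∃ i, w (simpleRoot i) = x}

/-- The positive real roots: nonnegative combinations of simple roots. -/
def posRoots : Set (I → ℤ) := {x | x ∈ realRoots A ∧ ∀ i, 0 ≤ x i}

/-- The negative real roots: nonpositive combinations of simple roots. -/
def negRoots : Set (I → ℤ) := {x | x ∈ realRoots A ∧ ∀ i, x i ≤ 0}

/-- A pair of real roots is prenilpotent if some element of the Weyl group sends both into the
positive roots and some element sends both into the negative roots. -/
def IsPrenilpotent (α β : realRoots A) : Prop :=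
  (∃ w ∈ weylGroup A, w (α : I → ℤ) ∈ posRoots A ∧ w (β : I → ℤ) ∈ posRoots A) ∧
  (∃ w ∈ weylGroup A, w (α : I → ℤ) ∈ negRoots A ∧ w (β : I → ℤ) ∈ negRoots A)

/-! ## The Kac–Moody algebra and the double basis of its real root spaces -/

/-- The (derived) Kac–Moody algebra over `ℂ`, given by Chevalley generators and Serre relations. -/
abbrev Alg : Type u := Matrix.ToLieAlgebra ℂ A

/-- The Chevalley generator `e_i`. -/
def genE (i : I) : Alg A :=
  LieSubmodule.Quotient.mk (N := CartanMatrix.Relations.toIdeal ℂ A)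
    (FreeLieAlgebra.of ℂ (CartanMatrix.Generators.E i))

/-- The Chevalley generator `f_i`. -/
def genF (i : I) : Alg A :=
  LieSubmodule.Quotient.mk (N := CartanMatrix.Relations.toIdeal ℂ A)
    (FreeLieAlgebra.of ℂ (CartanMatrix.Generators.F i))

/-- `exp (ad y)` applied to `x`, for `y` acting locally nilpotently (then the sum is finite). -/
def expAd (y x : Alg A) : Alg A :=
  ∑ᶠ n : ℕ, (n.factorial : ℂ)⁻¹ • ((LieAlgebra.ad ℂ (Alg A) y) ^ n) x

/-- The automorphism `s_i^* = exp(ad e_i) exp(-ad f_i) exp(ad e_i)` lifting the simple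
reflection in `α_i`. -/
def starReflection (i : I) (x : Alg A) : Alg A :=
  expAd A (genE A i) (expAd A (-genF A i) (expAd A (genE A i) x))

/-- `IsRootVector A α x` says that `x` belongs to the double basis `{e_α, -e_α}` of the root space
of the real root `α`. These are the images of the vectors `± e_i` under the group generated by
the `s_i^*`, placed in the root spaces of the corresponding images of `α_i`. -/
inductive IsRootVector : (I → ℤ) → Alg A → Prop
  | simple (i : I) : IsRootVector (simpleRoot i) (genE A i)
  | neg {α : I → ℤ} {x : Alg A} : IsRootVector α x → IsRootVector α (-x)
  | reflect (i : I) {α : I → ℤ} {x : Alg A} :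
      IsRootVector α x → IsRootVector (simpleReflection A i α) (starReflection A i x)

/-! ## Chevalley relations -/

/-- The enveloping algebra of the Kac–Moody algebra. -/
abbrev Env : Type u := UniversalEnvelopingAlgebra ℂ (Alg A)

/-- The formal power series `exp(c t^m u^n x)` in the commuting variables `t, u` (number `0`
and `1`) with coefficients in the enveloping algebra, for `(m, n) ≠ (0, 0)`: the coefficient at
the `k`-th power of the monomial `t^m u^n` is `c^k x^k / k!`, the others vanish.
(A power with `k > d 0 + d 1` cannot equal the monomial with exponent `d`.) -/
def expSeries (m n : ℕ) (c : ℤ) (x : Alg A) : MvPowerSeries (Fin 2) (Env A) :=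
  fun d => ∑ k ∈ Finset.range (d 0 + d 1 + 1),
    if d 0 = k * m ∧ d 1 = k * n then
      ((c : ℂ) ^ k * (k.factorial : ℂ)⁻¹) • (UniversalEnvelopingAlgebra.ι ℂ x) ^ k
    else 0

variable {A}

/-- A commutator formula for the real roots `α, β`, relative to the chosen root vectors `e`:
an enumeration `roots` of the real roots `γ = m γ • α + n γ • β` with natural numbers
`m γ, n γ`, other than `α` and `β`, and integers `c γ` such that, as formal power series in `t, u`,
`exp(t e_α) exp(u e_β) exp(-t e_α) exp(-u e_β) = ∏ γ, exp(c γ t^(m γ) u^(n γ) e_γ)`,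
the product being taken in the order of the enumeration. -/
structure CommutatorFormula (e : realRoots A → Alg A) (α β : realRoots A) where
  roots : List (realRoots A)
  nodup : roots.Nodup
  mem_roots : ∀ γ : realRoots A, γ ∈ roots ↔ γ ≠ α ∧ γ ≠ β ∧
    ∃ m n : ℕ, (γ : I → ℤ) = m • (α : I → ℤ) + n • (β : I → ℤ)
  m : realRoots A → ℕ
  n : realRoots A → ℕ
  expand : ∀ γ ∈ roots, (γ : I → ℤ) = m γ • (α : I → ℤ) + n γ • (β : I → ℤ)
  c : realRoots A → ℤ
  formula :
    expSeries A 1 0 1 (e α) * expSeries A 0 1 1 (e β) *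
        expSeries A 1 0 (-1) (e α) * expSeries A 0 1 (-1) (e β) =
      (roots.map fun γ => expSeries A (m γ) (n γ) (c γ) (e γ)).prod

variable (A)

/-- The free product, over the real roots, of copies `U_α` of the additive group of `R`. -/
abbrev FreeProd (R : Type v) [CommRing R] : Type (max u v) :=
  Monoid.CoprodI fun _ : realRoots A => Multiplicative R

variable {A}

/-- The element `X_α(t)` of the free product. -/
def X {R : Type v} [CommRing R] (α : realRoots A) (t : R) : FreeProd A R :=
  Monoid.CoprodI.of (M := fun _ : realRoots A => Multiplicative R) (i := α)
    (Multiplicative.ofAdd t)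

/-- The right side `∏ γ, X_γ(c γ t^(m γ) u^(n γ))` of the Chevalley relation that belongs to a
commutator formula. -/
def CommutatorFormula.rhs {e : realRoots A → Alg A} {α β : realRoots A}
    (F : CommutatorFormula e α β) {R : Type v} [CommRing R] (t u : R) : FreeProd A R :=
  (F.roots.map fun γ => X γ ((F.c γ : R) * t ^ F.m γ * u ^ F.n γ)).prod

/-- All the right sides (for all orderings of the intermediate roots) of the Chevalley
relation `[X_α(t), X_β(u)] = ∏ γ, X_γ(c γ t^(m γ) u^(n γ))` of the pair `α, β` at `t, u`. -/
def chevalleyRHS (e : realRoots A → Alg A) (α β : realRoots A) {R : Type v} [CommRing R]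
    (t u : R) : Set (FreeProd A R) :=
  {g | ∃ F : CommutatorFormula e α β, g = F.rhs t u}

/-- The relators of the Steinberg group: the Chevalley relations of all prenilpotent pairs. -/
def steinbergRelators (e : realRoots A → Alg A) (R : Type v) [CommRing R] :
    Set (FreeProd A R) :=
  {r | ∃ α β : realRoots A, IsPrenilpotent A α β ∧
    ∃ t u : R, ∃ g ∈ chevalleyRHS e α β t u, r = ⁅X α t, X β u⁆ * g⁻¹}

/-- The Steinberg group `St_A(R)`, where `X_α` corresponds to the root vector `e α`. -/
abbrev Steinberg (e : realRoots A → Alg A) (R : Type v) [CommRing R] : Type (max u v) :=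
  FreeProd A R ⧸ Subgroup.normalClosure (steinbergRelators e R)

/-- The element `X_α(t)` of the Steinberg group. -/
def stX (e : realRoots A → Alg A) {R : Type v} [CommRing R] (α : realRoots A) (t : R) :
    Steinberg e R :=
  QuotientGroup.mk (X α t)

end KacMoody

end

noncomputable section

set_option linter.unusedSectionVars false

namespace KacMoody

universe u v

/-! ## Exponentials of locally nilpotent inner derivations -/

section LieExp

/-! All real roots have norm 2, so `mα + nβ` can be a real root only if `m² + n² + mn(α·β) = 1`. For
`α·β ≥ 0` this leaves `α` and `β`; for `α·β = -1` it leaves `α`, `β` and `α + β`. Everything else is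
to identify the bracket of the two root vectors.

The main tool is an integral form of the Lie algebra: the iterated brackets of the generators span,
over the integers, a piece for each weight. In the simply laced case the divided powers of `ad e_i`
and `ad f_i` preserve the form, so the lifts `s_i^*` act on it and permute the pieces as the
reflections permute the weights. A triangular decomposition shows that a nonzero piece of nonzero
weight has a weight of one sign, and that the piece of `α_i` is spanned by `e_i`. Two facts follow.
A piece whose weight has norm greater than 2 is zero, by descent on the height
(`eq_zero_of_two_lt_dot`). A root vector generates its piece over the integers
(`IsRootVector.isGenerator`).

If `α·β ≥ 0`, then `α + β` has norm at least 4 and the root vectors commute. If `α·β = -1`, the Weyl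
group reduces the question to `α = α_i`, where the bracket with `e_i` coincides with `s_i^*`
(`refl_eq_lie`). So the bracket generates the piece of `α + β` and equals `e_{α+β}` up to sign. The
sign is determined because root vectors are nonzero, which is seen on a quotient of a free module
over the lowering operators (`vermaSystem`). The bracket commutes with both root vectors, so the
Heisenberg commutator formula evaluates the product of exponentials (`expMonomial_commutator`), and
the coefficient of `tu` makes the integer in the relation unique.

The criterion for prenilpotency is combinatorial. If `α·β ≤ -2`, infinitely many real roots are
nonnegative combinations of `α` and `β`, whereas an element of `W` makes only finitely many positive
roots negative (`infinite_combinations`, `finite_inversions`). If `α·β ≥ -1`, one or two reflections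
make both roots positive (`exists_map_pos`). -/

lemma sum_antidiagonal_eq_sum_sum {M : Type*} [AddCommMonoid M] (g : ℕ → ℕ → M) (N : ℕ)
    (h₁ : ∀ a b, N ≤ a → g a b = 0) (h₂ : ∀ a b, N ≤ b → g a b = 0) :
    ∑ n ∈ Finset.range (2 * N), ∑ p ∈ Finset.HasAntidiagonal.antidiagonal n, g p.1 p.2 =
      ∑ a ∈ Finset.range N, ∑ b ∈ Finset.range N, g a b := by
  rw [← Finset.sum_product', Finset.sum_sigma']
  symm
  refine Finset.sum_of_injOn (fun p => ⟨p.1 + p.2, p⟩) ?_ ?_ ?_ ?_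
  · intro p _ q _ hpq
    simpa using (Sigma.mk.inj hpq).2
  · intro p hp
    simp at hp ⊢
    omega
  · rintro ⟨n, p⟩ hp hp'
    simp only [Finset.mem_sigma, Finset.HasAntidiagonal.mem_antidiagonal] at hp
    by_cases hN : N ≤ p.1
    · exact h₁ _ _ hN
    by_cases hN' : N ≤ p.2
    · exact h₂ _ _ hN'
    refine absurd ⟨p, ?_, ?_⟩ hp'
    · simp; omega
    · simp [hp.2]
  · intros; rfl

variable {L : Type*} [LieRing L] [LieAlgebra ℂ L]

/-- The divided power `(ad u)^n / n!` applied to `y`. -/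
def dividedPow (u : L) (n : ℕ) (y : L) : L :=
  (n.factorial : ℂ)⁻¹ • ((LieAlgebra.ad ℂ L u) ^ n) y

@[simp] lemma dividedPow_zero (u y : L) : dividedPow u 0 y = y := by simp [dividedPow]

@[simp] lemma dividedPow_one (u y : L) : dividedPow u 1 y = ⁅u, y⁆ := by simp [dividedPow]

lemma dividedPow_two (u y : L) : dividedPow u 2 y = (2 : ℂ)⁻¹ • ⁅u, ⁅u, y⁆⁆ := by
  simp [dividedPow, pow_succ]

@[simp] lemma dividedPow_apply_zero (u : L) (n : ℕ) : dividedPow u n 0 = 0 := by simp [dividedPow]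

lemma dividedPow_add (u : L) (n : ℕ) (y z : L) :
    dividedPow u n (y + z) = dividedPow u n y + dividedPow u n z := by simp [dividedPow]

lemma dividedPow_neg (u : L) (n : ℕ) (y : L) :
    dividedPow u n (-y) = -dividedPow u n y := by simp [dividedPow]

lemma dividedPow_smul_left (c : ℤ) (u : L) (n : ℕ) (y : L) :
    dividedPow (c • u) n y = c ^ n • dividedPow u n y := by
  simp only [dividedPow, map_zsmul]
  rw [smul_pow, LinearMap.smul_apply, smul_comm]

lemma dividedPow_lie (u : L) (n : ℕ) (y z : L) :
    dividedPow u n ⁅y, z⁆ =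
      ∑ p ∈ Finset.HasAntidiagonal.antidiagonal n, ⁅dividedPow u p.1 y, dividedPow u p.2 z⁆ := by
  simp only [dividedPow, LieAlgebra.ad_pow_lie, Finset.smul_sum]
  refine Finset.sum_congr rfl fun p hp => ?_
  rw [Finset.HasAntidiagonal.mem_antidiagonal] at hp
  subst hp
  rw [smul_lie, lie_smul, smul_smul, ← Nat.cast_smul_eq_nsmul ℂ, smul_smul]
  congr 1
  rw [Nat.choose_symm_add, Nat.add_choose, Nat.cast_div (Nat.factorial_mul_factorial_dvd_factorial_add _ _)]
  · have := Nat.factorial_ne_zero (p.1 + p.2)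
    push_cast
    field_simp
  · exact_mod_cast mul_ne_zero (Nat.factorial_ne_zero _) (Nat.factorial_ne_zero _)

lemma dividedPow_dividedPow (u : L) (m n : ℕ) (y : L) :
    dividedPow u m (dividedPow u n y) = (m + n).choose m • dividedPow u (m + n) y := by
  simp only [dividedPow, map_smul, smul_smul]
  rw [← Nat.cast_smul_eq_nsmul ℂ, smul_smul, ← Module.End.mul_apply, ← pow_add]
  congr 1
  rw [Nat.choose_symm_add, Nat.add_choose, Nat.cast_div (Nat.factorial_mul_factorial_dvd_factorial_add _ _)]
  · have := Nat.factorial_ne_zero (m + n)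
    push_cast
    field_simp
  · exact_mod_cast mul_ne_zero (Nat.factorial_ne_zero _) (Nat.factorial_ne_zero _)

lemma dividedPow_eq_zero_of_le {u y : L} {k n : ℕ} (h : dividedPow u k y = 0) (hn : k ≤ n) :
    dividedPow u n y = 0 := by
  have h' : ((LieAlgebra.ad ℂ L u) ^ k) y = 0 := by
    simpa [dividedPow, Nat.factorial_ne_zero] using h
  obtain ⟨m, rfl⟩ := Nat.exists_eq_add_of_le' hn
  rw [dividedPow, pow_add, Module.End.mul_apply, h', map_zero, smul_zero]

/-- The vectors on which `ad u` acts nilpotently. -/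
def adNilpotent (u : L) : AddSubgroup L where
  carrier := {y | ∃ N, dividedPow u N y = 0}
  zero_mem' := ⟨0, by simp⟩
  add_mem' := by
    rintro y z ⟨N, hN⟩ ⟨M, hM⟩
    exact ⟨max N M, by rw [dividedPow_add, dividedPow_eq_zero_of_le hN (le_max_left _ _),
      dividedPow_eq_zero_of_le hM (le_max_right _ _), add_zero]⟩
  neg_mem' := by
    rintro y ⟨N, hN⟩
    exact ⟨N, by rw [dividedPow_neg, hN, neg_zero]⟩

/-- `exp (ad u)` applied to `y`, a finite sum if `ad u` acts nilpotently on `y`. -/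
def lieExp (u y : L) : L := ∑ᶠ n : ℕ, dividedPow u n y

lemma lieExp_eq_sum {u y : L} {N : ℕ} (h : dividedPow u N y = 0) :
    lieExp u y = ∑ n ∈ Finset.range N, dividedPow u n y := by
  refine finsum_eq_sum_of_support_subset _ fun n hn => ?_
  by_contra hn'
  exact hn (dividedPow_eq_zero_of_le h (by simpa using hn'))

lemma lieExp_zero (u : L) : lieExp u 0 = 0 := by simp [lieExp]

lemma lieExp_neg (u y : L) : lieExp u (-y) = -lieExp u y := by
  simp only [lieExp, dividedPow_neg, finsum_neg_distrib]

lemma lieExp_add {u y z : L} (hy : y ∈ adNilpotent u) (hz : z ∈ adNilpotent u) :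
    lieExp u (y + z) = lieExp u y + lieExp u z := by
  obtain ⟨N, hN⟩ := hy
  obtain ⟨M, hM⟩ := hz
  have hN' := dividedPow_eq_zero_of_le hN (le_max_left N M)
  have hM' := dividedPow_eq_zero_of_le hM (le_max_right N M)
  rw [lieExp_eq_sum hN', lieExp_eq_sum hM', lieExp_eq_sum (N := max N M), ← Finset.sum_add_distrib]
  · simp only [dividedPow_add]
  · rw [dividedPow_add, hN', hM', add_zero]

/-- Leibniz rule for divided powers. Both exponentials stop below a common bound `N`, and the
antidiagonal sums of order below `2N` fill the square of side `N`. -/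
lemma lieExp_lie {u y z : L} (hy : y ∈ adNilpotent u) (hz : z ∈ adNilpotent u) :
    lieExp u ⁅y, z⁆ = ⁅lieExp u y, lieExp u z⁆ := by
  obtain ⟨N, hN⟩ := hy
  obtain ⟨M, hM⟩ := hz
  have hN' := dividedPow_eq_zero_of_le hN (le_max_left N M)
  have hM' := dividedPow_eq_zero_of_le hM (le_max_right N M)
  have key := sum_antidiagonal_eq_sum_sum (fun a b => ⁅dividedPow u a y, dividedPow u b z⁆)
    (max N M) (fun a b h => by simp only [dividedPow_eq_zero_of_le hN' h, zero_lie])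
    (fun a b h => by simp only [dividedPow_eq_zero_of_le hM' h, lie_zero])
  rw [lieExp_eq_sum hN', lieExp_eq_sum hM', lieExp_eq_sum (N := 2 * max N M)]
  · simp only [dividedPow_lie, key, sum_lie, lie_sum]
    exact Finset.sum_comm
  · rw [dividedPow_lie]
    refine Finset.sum_eq_zero fun p hp => ?_
    rw [Finset.HasAntidiagonal.mem_antidiagonal] at hp
    rcases le_total (max N M) p.1 with h | h
    · rw [dividedPow_eq_zero_of_le hN' h, zero_lie]
    · rw [dividedPow_eq_zero_of_le hM' (by omega), lie_zero]

/-- The coefficient of the `n`-th divided power in the composite is the alternating sum of the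
binomial coefficients of `n`, which vanishes for `n > 0`. -/
lemma lieExp_neg_lieExp {u y : L} (hy : y ∈ adNilpotent u) : lieExp (-u) (lieExp u y) = y := by
  have hneg : ∀ n z, dividedPow (-u) n z = (-1 : ℤ) ^ n • dividedPow u n z := fun n z => by
    rw [← dividedPow_smul_left]; simp
  obtain ⟨N, hN⟩ := hy
  have hg : ∀ a b, dividedPow (-u) a (dividedPow u b y) =
      ((-1 : ℤ) ^ a * ((a + b).choose a : ℤ)) • dividedPow u (a + b) y := fun a b => by
    rw [hneg, dividedPow_dividedPow, ← natCast_zsmul, smul_smul]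
  have key := sum_antidiagonal_eq_sum_sum (fun a b => dividedPow (-u) a (dividedPow u b y)) N
    (fun a b h => by simp only [hg, dividedPow_eq_zero_of_le hN (by omega : N ≤ a + b), smul_zero])
    (fun a b h => by simp only [dividedPow_eq_zero_of_le hN h, dividedPow_apply_zero])
  have hsum : lieExp (-u) (lieExp u y) =
      ∑ n ∈ Finset.range N, ∑ m ∈ Finset.range N, dividedPow (-u) n (dividedPow u m y) := by
    rw [lieExp_eq_sum hN, lieExp_eq_sum (N := N)]
    · refine Finset.sum_congr rfl fun n _ => ?_
      simp only [dividedPow, map_sum, Finset.smul_sum]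
    · have : dividedPow (-u) N (∑ n ∈ Finset.range N, dividedPow u n y) =
          ∑ n ∈ Finset.range N, dividedPow (-u) N (dividedPow u n y) := by
        simp only [dividedPow, map_sum, Finset.smul_sum]
      rw [this]
      refine Finset.sum_eq_zero fun n _ => ?_
      rw [hg, dividedPow_eq_zero_of_le hN (by omega), smul_zero]
  rw [hsum, ← key]
  have hinner : ∀ n, ∑ p ∈ Finset.HasAntidiagonal.antidiagonal n, dividedPow (-u) p.1 (dividedPow u p.2 y) =
      if n = 0 then y else 0 := fun n => by
    have : ∑ p ∈ Finset.HasAntidiagonal.antidiagonal n, dividedPow (-u) p.1 (dividedPow u p.2 y) =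
        (∑ p ∈ Finset.HasAntidiagonal.antidiagonal n, (-1 : ℤ) ^ p.1 * (n.choose p.1 : ℤ)) • dividedPow u n y := by
      rw [Finset.sum_smul]
      refine Finset.sum_congr rfl fun p hp => ?_
      rw [Finset.HasAntidiagonal.mem_antidiagonal] at hp
      rw [hg, hp]
    rw [this, Finset.Nat.sum_antidiagonal_eq_sum_range_succ_mk,
      Int.alternating_sum_range_choose]
    split_ifs with h
    · subst h; simp
    · simp
  simp only [hinner]
  rcases Nat.eq_zero_or_pos N with rfl | hpos
  · simpa using hN.symm
  · rw [Finset.sum_ite_eq', if_pos (by simpa using hpos)]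

lemma lieExp_eq_of_sq {u y : L} (h : ⁅u, ⁅u, y⁆⁆ = 0) : lieExp u y = y + ⁅u, y⁆ := by
  rw [lieExp_eq_sum (N := 2) (by rw [dividedPow_two, h, smul_zero])]
  simp [Finset.sum_range_succ]

lemma lieExp_eq_of_cube {u y z : L} (h₂ : ⁅u, ⁅u, y⁆⁆ = (2 : ℤ) • z) (h₃ : ⁅u, z⁆ = 0) :
    lieExp u y = y + ⁅u, y⁆ + z := by
  have hz : dividedPow u 2 y = z := by
    rw [dividedPow_two, h₂, ← Int.cast_smul_eq_zsmul ℂ, smul_smul]; simp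
  rw [lieExp_eq_sum (N := 3)]
  · simp [Finset.sum_range_succ, hz]
  -- `ad u` times the divided square is three times the divided cube, so the divided cube vanishes.
  · have := dividedPow_dividedPow u 1 2 y
    rw [hz, dividedPow_one, h₃] at this
    have h3 : (3 : ℕ) • dividedPow u 3 y = 0 := by simpa using this.symm
    rw [← Nat.cast_smul_eq_nsmul ℂ] at h3
    exact (smul_eq_zero.mp h3).resolve_left (by norm_num)

end LieExp

/-! ## The form on the root lattice -/

section Form

variable {I : Type u} [Fintype I] [DecidableEq I] (A : Matrix I I ℤ)

lemma dot_add_left (x y z : I → ℤ) : dot A (x + y) z = dot A x z + dot A y z := by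
  simp [dot]

lemma dot_add_right (x y z : I → ℤ) : dot A x (y + z) = dot A x y + dot A x z := by
  simp [dot, Matrix.mulVec_add]

lemma dot_smul_left (c : ℤ) (x z : I → ℤ) : dot A (c • x) z = c * dot A x z := by
  rw [dot, dot, smul_dotProduct, smul_eq_mul]

lemma dot_smul_right (c : ℤ) (x z : I → ℤ) : dot A x (c • z) = c * dot A x z := by
  rw [dot, dot, Matrix.mulVec_smul, dotProduct_smul, smul_eq_mul]

lemma dot_neg_left (x z : I → ℤ) : dot A (-x) z = -dot A x z := by
  simp [dot]

lemma dot_neg_right (x z : I → ℤ) : dot A x (-z) = -dot A x z := by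
  simp [dot, Matrix.mulVec_neg]

lemma dot_sub_left (x y z : I → ℤ) : dot A (x - y) z = dot A x z - dot A y z := by
  simp [dot]

lemma dot_sub_right (x y z : I → ℤ) : dot A x (y - z) = dot A x y - dot A x z := by
  simp [dot, Matrix.mulVec_sub]

lemma dot_simpleRoot_simpleRoot (i j : I) : dot A (simpleRoot i) (simpleRoot j) = A i j := by
  simp [dot, simpleRoot]

lemma sum_smul_simpleRoot (x : I → ℤ) : ∑ i, x i • (simpleRoot i : I → ℤ) = x := by
  ext j
  simp [simpleRoot, Finset.sum_apply, Pi.single_apply]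

lemma dot_eq_sum_right (x y : I → ℤ) : dot A x y = ∑ i, y i * dot A x (simpleRoot i) := by
  conv_lhs => rw [← sum_smul_simpleRoot y]
  rw [dot, Matrix.mulVec_sum, dotProduct_sum]
  exact Finset.sum_congr rfl fun i _ => dot_smul_right A (y i) x (simpleRoot i)

variable {A} in
lemma dot_comm (hA : ∀ i j, A i j = A j i) (x y : I → ℤ) : dot A x y = dot A y x := by
  have : Aᵀ = A := by ext i j; exact hA j i
  rw [dot, dot, dotProduct_comm, Matrix.dotProduct_mulVec, ← Matrix.mulVec_transpose, this]

end Form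

/-! ## Systems of Chevalley generators of simply laced type -/

/-- The sign attached to raising (`true`) and lowering (`false`) generators. -/
def sgn (s : Bool) : ℤ := if s then 1 else -1

@[simp] lemma sgn_not (s : Bool) : sgn (!s) = -sgn s := by cases s <;> simp [sgn]

lemma sgn_mul_self (s : Bool) : sgn s * sgn s = 1 := by cases s <;> simp [sgn]

lemma sgn_ne_zero (s : Bool) : sgn s ≠ 0 := by cases s <;> simp [sgn]

/-- Elements of a Lie algebra that satisfy the Chevalley relations of a simply laced
generalized Cartan matrix, the `e_i` being `x true i` and the `f_i` being `x false i`. -/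
structure ChevalleyGenerators {I : Type u} [DecidableEq I] (A : Matrix I I ℤ) (L : Type v)
    [LieRing L] [LieAlgebra ℂ L] where
  x : Bool → I → L
  h : I → L
  diag : ∀ i, A i i = 2
  symm : ∀ i j, A i j = A j i
  off_diag : ∀ i j, i ≠ j → A i j = 0 ∨ A i j = -1
  lie_h_h : ∀ i j, ⁅h i, h j⁆ = 0
  lie_h_x : ∀ s i j, ⁅h i, x s j⁆ = (sgn s * A i j) • x s j
  lie_x_x_not : ∀ s i j, ⁅x s i, x (!s) j⁆ = if i = j then sgn s • h i else 0

/-- Elements of a Lie algebra that satisfy the Chevalley–Serre relations of a simply laced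
generalized Cartan matrix. -/
structure ChevalleySystem {I : Type u} [DecidableEq I] (A : Matrix I I ℤ) (L : Type v)
    [LieRing L] [LieAlgebra ℂ L] extends ChevalleyGenerators A L where
  serre_zero : ∀ s i j, i ≠ j → A i j = 0 → ⁅x s i, x s j⁆ = 0
  serre_neg_one : ∀ s i j, A i j = -1 → ⁅x s i, ⁅x s i, x s j⁆⁆ = 0

namespace ChevalleySystem

variable {I : Type u} [Fintype I] [DecidableEq I] {A : Matrix I I ℤ} {L : Type v} [LieRing L]
  [LieAlgebra ℂ L] (S : ChevalleySystem A L)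

lemma dot_comm (S : ChevalleySystem A L) (x y : I → ℤ) : dot A x y = dot A y x := KacMoody.dot_comm S.symm x y

/-- Membership in the piece of weight `γ` of the integral form spanned by the iterated brackets of
the generators. -/
inductive IsIntegral : (I → ℤ) → L → Prop
  | gen (s : Bool) (i : I) : IsIntegral (sgn s • simpleRoot i) (S.x s i)
  | lie (s : Bool) (i : I) {γ : I → ℤ} {y : L} :
      IsIntegral γ y → IsIntegral (sgn s • simpleRoot i + γ) ⁅S.x s i, y⁆
  | zero (γ : I → ℤ) : IsIntegral γ 0
  | add {γ : I → ℤ} {y z : L} : IsIntegral γ y → IsIntegral γ z → IsIntegral γ (y + z)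
  | neg {γ : I → ℤ} {y : L} : IsIntegral γ y → IsIntegral γ (-y)

/-- The piece of weight `γ` of the integral form. -/
def piece (γ : I → ℤ) : AddSubgroup L where
  carrier := {y | S.IsIntegral γ y}
  zero_mem' := .zero γ
  add_mem' := .add
  neg_mem' := .neg

lemma mem_piece {γ : I → ℤ} {y : L} : y ∈ S.piece γ ↔ S.IsIntegral γ y := Iff.rfl

lemma x_mem (s : Bool) (i : I) : S.x s i ∈ S.piece (sgn s • simpleRoot i) := .gen s i

lemma mem_piece_congr {γ δ : I → ℤ} {y : L} (hy : y ∈ S.piece γ) (h : γ = δ) : y ∈ S.piece δ :=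
  h ▸ hy

/-- Only brackets with a generator on the left are built into `IsIntegral`. The Jacobi identity
unwinds the left factor, with `z` and its weight kept general in the induction. -/
lemma lie_mem {γ δ : I → ℤ} {y z : L} (hy : y ∈ S.piece γ) (hz : z ∈ S.piece δ) :
    ⁅y, z⁆ ∈ S.piece (γ + δ) := by
  rw [mem_piece] at hy
  induction hy generalizing δ z with
  | gen s i => exact .lie s i hz
  | @lie s i γ y _ ih =>
    rw [lie_lie]
    refine sub_mem ?_ ?_
    · rw [add_assoc]
      exact .lie s i (ih hz)
    · refine S.mem_piece_congr (ih (.lie s i hz)) (by abel)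
  | zero => rw [zero_lie]; exact zero_mem _
  | add _ _ ih₁ ih₂ => rw [add_lie]; exact add_mem (ih₁ hz) (ih₂ hz)
  | neg _ ih => rw [neg_lie]; exact neg_mem (ih hz)

lemma h_mem (i : I) : S.h i ∈ S.piece 0 := by
  have h := S.lie_mem (S.x_mem true i) (S.x_mem false i)
  have h' := S.lie_x_x_not true i i
  simp only [sgn, Bool.not_true, if_true, one_smul] at h'
  rw [h'] at h
  exact S.mem_piece_congr h (by simp [sgn])

lemma lie_h {γ : I → ℤ} {y : L} (hy : y ∈ S.piece γ) (i : I) :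
    ⁅S.h i, y⁆ = dot A γ (simpleRoot i) • y := by
  rw [mem_piece] at hy
  induction hy with
  | gen s j => rw [S.lie_h_x, dot_smul_left, dot_simpleRoot_simpleRoot, S.symm]
  | @lie s j γ y _ ih =>
    rw [leibniz_lie, ih, S.lie_h_x, lie_smul, smul_lie, ← add_smul, dot_add_left, dot_smul_left,
      dot_simpleRoot_simpleRoot, S.symm i j]
  | zero => simp
  | add _ _ ih₁ ih₂ => rw [lie_add, ih₁, ih₂, smul_add]
  | neg _ ih => rw [lie_neg, ih, smul_neg]

/-- The square of `ad (x s i)` on a generator is twice an integral element killed by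
`ad (x s i)`. -/
lemma lie_lie_gen (s s' : Bool) (i j : I) :
    ∃ z ∈ S.piece (sgn s' • simpleRoot j + (2 : ℤ) • sgn s • simpleRoot i),
      ⁅S.x s i, ⁅S.x s i, S.x s' j⁆⁆ = (2 : ℤ) • z ∧ ⁅S.x s i, z⁆ = 0 := by
  by_cases hs : s' = s
  · subst hs
    refine ⟨0, zero_mem _, ?_, lie_zero _⟩
    rw [smul_zero]
    by_cases hij : i = j
    · subst hij; simp
    · rcases S.off_diag i j hij with h | h
      · rw [S.serre_zero s' i j hij h, lie_zero]
      · exact S.serre_neg_one s' i j h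
  · have hs' : s' = !s := by cases s <;> cases s' <;> simp_all
    subst hs'
    rw [S.lie_x_x_not]
    by_cases hij : i = j
    · subst hij
      refine ⟨-S.x s i, ?_, ?_, by simp⟩
      · refine neg_mem (S.mem_piece_congr (S.x_mem s i) ?_)
        rw [sgn_not]; module
      · rw [if_pos rfl, lie_smul, ← lie_skew, S.lie_h_x, S.diag, smul_neg, smul_smul,
          ← mul_assoc, sgn_mul_self, one_mul, smul_neg]
    · exact ⟨0, zero_mem _, by simp [hij], lie_zero _⟩

/-- On generators the square of `ad (x s i)` is divisible by 2 and the cube is zero (`lie_lie_gen`);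
the Leibniz rule extends integrality and local nilpotency to all iterated brackets. -/
lemma dividedPow_mem_and_adNilpotent (s : Bool) (i : I) {γ : I → ℤ} {y : L}
    (hy : y ∈ S.piece γ) :
    (∀ n : ℕ, dividedPow (S.x s i) n y ∈ S.piece (γ + (n : ℤ) • sgn s • simpleRoot i)) ∧
      y ∈ adNilpotent (S.x s i) := by
  rw [mem_piece] at hy
  have hgen : ∀ s' j, (∀ n : ℕ, dividedPow (S.x s i) n (S.x s' j) ∈
      S.piece (sgn s' • simpleRoot j + (n : ℤ) • sgn s • simpleRoot i)) ∧
      dividedPow (S.x s i) 3 (S.x s' j) = 0 := by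
    intro s' j
    obtain ⟨z, hz, h₂, h₃⟩ := S.lie_lie_gen s s' i j
    have hz' : dividedPow (S.x s i) 2 (S.x s' j) = z := by
      rw [dividedPow_two, h₂, ← Int.cast_smul_eq_zsmul ℂ, smul_smul]; simp
    have h3 : dividedPow (S.x s i) 3 (S.x s' j) = 0 := by
      have := dividedPow_dividedPow (S.x s i) 1 2 (S.x s' j)
      rw [hz', dividedPow_one, h₃] at this
      have h3 : (3 : ℕ) • dividedPow (S.x s i) 3 (S.x s' j) = 0 := by simpa using this.symm
      rw [← Nat.cast_smul_eq_nsmul ℂ] at h3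
      exact (smul_eq_zero.mp h3).resolve_left (by norm_num)
    refine ⟨fun n => ?_, h3⟩
    match n with
    | 0 => simpa using S.x_mem s' j
    | 1 =>
      rw [dividedPow_one]
      exact S.mem_piece_congr (S.lie_mem (S.x_mem s i) (S.x_mem s' j)) (by push_cast; module)
    | 2 => rw [hz']; exact_mod_cast hz
    | n + 3 => rw [dividedPow_eq_zero_of_le h3 (by omega)]; exact zero_mem _
  induction hy with
  | gen s' j => exact ⟨(hgen s' j).1, 3, (hgen s' j).2⟩
  | @lie s' j γ y _ ih =>
    obtain ⟨ih, N, hN⟩ := ih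
    -- In a Leibniz term of order `N + 3` either the generator is hit at least three times or `y` at
    -- least `N` times.
    refine ⟨fun n => ?_, N + 3, ?_⟩
    · rw [dividedPow_lie]
      refine sum_mem fun p hp => ?_
      rw [Finset.HasAntidiagonal.mem_antidiagonal] at hp
      refine S.mem_piece_congr (S.lie_mem ((hgen s' j).1 p.1) (ih p.2)) ?_
      rw [← hp]; push_cast; module
    · rw [dividedPow_lie]
      refine Finset.sum_eq_zero fun p hp => ?_
      rw [Finset.HasAntidiagonal.mem_antidiagonal] at hp
      rcases le_or_gt 3 p.1 with h | h
      · rw [dividedPow_eq_zero_of_le (hgen s' j).2 h, zero_lie]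
      · rw [dividedPow_eq_zero_of_le hN (by omega), lie_zero]
  | zero => exact ⟨fun n => by rw [dividedPow_apply_zero]; exact zero_mem _, zero_mem _⟩
  | add _ _ ih₁ ih₂ =>
    exact ⟨fun n => by rw [dividedPow_add]; exact add_mem (ih₁.1 n) (ih₂.1 n),
      add_mem ih₁.2 ih₂.2⟩
  | neg _ ih => exact ⟨fun n => by rw [dividedPow_neg]; exact neg_mem (ih.1 n), neg_mem ih.2⟩

/-! ### The integral form and its automorphisms -/

/-- The integral form, the sum of the pieces of all weights. -/
def form : AddSubgroup L := ⨆ γ, S.piece γ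

/-- The sum of the pieces along the `α_i`-string through `γ`. -/
def stringForm (i : I) (γ : I → ℤ) : AddSubgroup L := ⨆ n : ℤ, S.piece (γ + n • simpleRoot i)

lemma piece_le_form (γ : I → ℤ) : S.piece γ ≤ S.form := le_iSup S.piece γ

lemma piece_le_stringForm (i : I) (γ : I → ℤ) : S.piece γ ≤ S.stringForm i γ := by
  refine le_of_eq_of_le ?_ (le_iSup (fun n : ℤ => S.piece (γ + n • simpleRoot i)) 0)
  rw [zero_smul, add_zero]

lemma stringForm_le_form (i : I) (γ : I → ℤ) : S.stringForm i γ ≤ S.form :=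
  iSup_le fun _ => S.piece_le_form _

/-- The product `exp(c • ad (x s i))` with an integer `c`. -/
def unip (s : Bool) (i : I) (c : ℤ) (y : L) : L := lieExp (c • S.x s i) y

lemma dividedPow_smul_eq_zero {u y : L} {N : ℕ} (c : ℤ) (h : dividedPow u N y = 0) :
    dividedPow (c • u) N y = 0 := by rw [dividedPow_smul_left, h, smul_zero]

lemma mem_adNilpotent_of_mem_piece (s : Bool) (i : I) (c : ℤ) {γ : I → ℤ} {y : L}
    (hy : y ∈ S.piece γ) : y ∈ adNilpotent (c • S.x s i) := by
  obtain ⟨N, hN⟩ := (S.dividedPow_mem_and_adNilpotent s i hy).2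
  exact ⟨N, dividedPow_smul_eq_zero c hN⟩

lemma mem_adNilpotent_of_mem_form (s : Bool) (i : I) (c : ℤ) {y : L}
    (hy : y ∈ S.form) : y ∈ adNilpotent (c • S.x s i) :=
  (iSup_le fun _ _ => S.mem_adNilpotent_of_mem_piece s i c : S.form ≤ adNilpotent (c • S.x s i)) hy

lemma unip_add (s : Bool) (i : I) (c : ℤ) {y z : L} (hy : y ∈ S.form) (hz : z ∈ S.form) :
    S.unip s i c (y + z) = S.unip s i c y + S.unip s i c z :=
  lieExp_add (S.mem_adNilpotent_of_mem_form s i c hy) (S.mem_adNilpotent_of_mem_form s i c hz)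

lemma unip_lie (s : Bool) (i : I) (c : ℤ) {y z : L} (hy : y ∈ S.form) (hz : z ∈ S.form) :
    S.unip s i c ⁅y, z⁆ = ⁅S.unip s i c y, S.unip s i c z⁆ :=
  lieExp_lie (S.mem_adNilpotent_of_mem_form s i c hy) (S.mem_adNilpotent_of_mem_form s i c hz)

lemma unip_neg_unip (s : Bool) (i : I) (c : ℤ) {y : L} (hy : y ∈ S.form) :
    S.unip s i (-c) (S.unip s i c y) = y := by
  rw [unip, neg_smul]
  exact lieExp_neg_lieExp (S.mem_adNilpotent_of_mem_form s i c hy)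

lemma unip_mem_stringForm (s : Bool) (i : I) (c : ℤ) {γ : I → ℤ} {y : L}
    (hy : y ∈ S.stringForm i γ) : S.unip s i c y ∈ S.stringForm i γ := by
  rw [stringForm] at hy
  induction hy using AddSubgroup.iSup_induction' with
  | hp n y hy =>
    obtain ⟨hm, N, hN⟩ := S.dividedPow_mem_and_adNilpotent s i hy
    rw [unip, lieExp_eq_sum (dividedPow_smul_eq_zero c hN)]
    refine sum_mem fun k _ => ?_
    rw [dividedPow_smul_left]
    refine zsmul_mem ?_ _
    refine le_iSup (fun n : ℤ => S.piece (γ + n • simpleRoot i)) (n + k * sgn s) ?_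
    exact S.mem_piece_congr (hm k) (by module)
  | h1 => rw [unip, lieExp_zero]; exact zero_mem _
  | hadd y z hy hz ihy ihz =>
    rw [S.unip_add s i c (S.stringForm_le_form i γ hy) (S.stringForm_le_form i γ hz)]
    exact add_mem ihy ihz

lemma unip_mem_form (s : Bool) (i : I) (c : ℤ) {y : L} (hy : y ∈ S.form) :
    S.unip s i c y ∈ S.form := by
  rw [form] at hy
  induction hy using AddSubgroup.iSup_induction' with
  | hp γ y hy =>
    exact S.stringForm_le_form i γ (S.unip_mem_stringForm s i c (S.piece_le_stringForm i γ hy))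
  | h1 => rw [unip, lieExp_zero]; exact zero_mem _
  | hadd y z hy hz ihy ihz =>
    rw [S.unip_add s i c hy hz]
    exact add_mem ihy ihz

/-- The lift `exp(c • ad e_i) exp(-c • ad f_i) exp(c • ad e_i)` of the reflection in `α_i`. -/
def refl (i : I) (c : ℤ) (y : L) : L :=
  S.unip true i c (S.unip false i (-c) (S.unip true i c y))

lemma refl_mem_stringForm (i : I) (c : ℤ) {γ : I → ℤ} {y : L}
    (hy : y ∈ S.stringForm i γ) : S.refl i c y ∈ S.stringForm i γ :=
  S.unip_mem_stringForm _ _ _ (S.unip_mem_stringForm _ _ _ (S.unip_mem_stringForm _ _ _ hy))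

lemma refl_zero (i : I) (c : ℤ) : S.refl i c 0 = 0 := by simp [refl, unip, lieExp_zero]

lemma refl_neg (i : I) (c : ℤ) (y : L) : S.refl i c (-y) = -S.refl i c y := by
  simp [refl, unip, lieExp_neg]

lemma refl_add (i : I) (c : ℤ) {y z : L} (hy : y ∈ S.form) (hz : z ∈ S.form) :
    S.refl i c (y + z) = S.refl i c y + S.refl i c z := by
  rw [refl, S.unip_add _ _ _ hy hz, S.unip_add, S.unip_add, refl, refl]
  all_goals repeat first | exact hy | exact hz | refine S.unip_mem_form _ _ _ ?_

lemma refl_zsmul (i : I) (c k : ℤ) {y : L} (hy : y ∈ S.form) :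
    S.refl i c (k • y) = k • S.refl i c y := by
  induction k with
  | zero => simp [refl_zero]
  | succ n ih => rw [add_smul, one_smul, S.refl_add i c (zsmul_mem hy _) hy, ih, add_smul, one_smul]
  | pred n ih =>
    rw [sub_smul, one_smul, sub_eq_add_neg, S.refl_add i c (zsmul_mem hy _) (neg_mem hy), ih,
      refl_neg, sub_smul, one_smul, sub_eq_add_neg]

lemma refl_lie (i : I) (c : ℤ) {y z : L} (hy : y ∈ S.form) (hz : z ∈ S.form) :
    S.refl i c ⁅y, z⁆ = ⁅S.refl i c y, S.refl i c z⁆ := by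
  rw [refl, S.unip_lie _ _ _ hy hz, S.unip_lie, S.unip_lie, refl, refl]
  all_goals repeat first | exact hy | exact hz | refine S.unip_mem_form _ _ _ ?_

lemma refl_neg_refl (i : I) (c : ℤ) {y : L} (hy : y ∈ S.form) :
    S.refl i (-c) (S.refl i c y) = y := by
  rw [refl, refl, S.unip_neg_unip true i c, S.unip_neg_unip false i (-c),
    S.unip_neg_unip true i c hy]
  all_goals repeat first | exact hy | refine S.unip_mem_form _ _ _ ?_

lemma lie_f_e (i : I) : ⁅S.x false i, S.x true i⁆ = -S.h i := by
  simpa [sgn] using S.lie_x_x_not false i i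

/-- A computation in the `sl₂` of the node. Both signs `c = ±1` are needed, since `refl i (-c)`
inverts `refl i c`. -/
lemma refl_h (i : I) {c : ℤ} (hc : c * c = 1) : S.refl i c (S.h i) = -S.h i := by
  have he : ⁅S.x true i, S.h i⁆ = (-2 : ℤ) • S.x true i := by
    rw [← lie_skew, S.lie_h_x, S.diag, ← neg_smul]; simp [sgn]
  have hf : ⁅S.x false i, S.h i⁆ = (2 : ℤ) • S.x false i := by
    rw [← lie_skew, S.lie_h_x, S.diag, ← neg_smul]; simp [sgn]
  have form_h : S.h i ∈ S.form := S.piece_le_form _ (S.h_mem i)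
  have form_x : ∀ s, S.x s i ∈ S.form := fun s => S.piece_le_form _ (S.x_mem s i)
  have h₁ : S.unip true i c (S.h i) = S.h i + (-(2 * c)) • S.x true i := by
    rw [unip, lieExp_eq_of_sq]
    · rw [smul_lie, he]; module
    · simp [smul_lie, he]
  have h₂ : S.unip true i c (S.x true i) = S.x true i := by
    rw [unip, lieExp_eq_of_sq] <;> simp
  have h₃ : S.unip false i (-c) (S.h i) = S.h i + (-(2 * c)) • S.x false i := by
    rw [unip, lieExp_eq_of_sq]
    · rw [smul_lie, hf]; module
    · simp [smul_lie, hf]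
  have h₄ : S.unip false i (-c) (S.x true i) = S.x true i + c • S.h i - S.x false i := by
    rw [unip, lieExp_eq_of_cube (z := -S.x false i)]
    · rw [smul_lie, S.lie_f_e]; module
    · rw [smul_lie, smul_lie, S.lie_f_e, lie_smul, lie_neg, hf]
      linear_combination (norm := module) (-2 : ℤ) • hc • S.x false i
    · simp
  have hu : ∀ s (c k : ℤ) {y : L}, y ∈ S.form → S.unip s i c (k • y) = k • S.unip s i c y := by
    intro s c k y hy
    induction k with
    | zero => simp [unip, lieExp_zero]
    | succ n ih =>
      rw [add_smul, one_smul, S.unip_add s i c (zsmul_mem hy _) hy, ih, add_smul, one_smul]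
    | pred n ih =>
      rw [sub_smul, one_smul, sub_eq_add_neg, S.unip_add s i c (zsmul_mem hy _) (neg_mem hy), ih,
        sub_smul, one_smul, sub_eq_add_neg]
      simp [unip, lieExp_neg]
  have h₅ : S.unip false i (-c) (S.h i + (-(2 * c)) • S.x true i) =
      (-1 : ℤ) • S.h i + (-(2 * c)) • S.x true i := by
    rw [S.unip_add _ _ _ form_h (zsmul_mem (form_x _) _), hu _ _ _ (form_x _), h₃, h₄]
    linear_combination (norm := module) (-2 : ℤ) • hc • S.h i
  rw [refl, h₁, h₅, S.unip_add _ _ _ (zsmul_mem form_h _) (zsmul_mem (form_x _) _),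
    hu _ _ _ form_h, hu _ _ _ (form_x _), h₁, h₂]
  module

/-- An element of a string that is an eigenvector of `h_i` lies in the corresponding piece. -/
lemma mem_piece_of_mem_stringForm {i : I} {γ : I → ℤ} {y : L} (hy : y ∈ S.stringForm i γ) (n : ℤ)
    (h : ⁅S.h i, y⁆ = (dot A γ (simpleRoot i) + 2 * n) • y) :
    y ∈ S.piece (γ + n • simpleRoot i) := by
  set D := LieAlgebra.ad ℂ L (S.h i)
  set a := dot A γ (simpleRoot i)
  have heig : ∀ m : ℤ, ∀ z ∈ S.piece (γ + m • simpleRoot i),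
      z ∈ Module.End.eigenspace D ((a + 2 * m : ℤ) : ℂ) := by
    intro m z hz
    rw [Module.End.mem_eigenspace_iff, LieAlgebra.ad_apply, S.lie_h hz, Int.cast_smul_eq_zsmul]
    congr 1
    rw [dot_add_left, dot_smul_left, dot_simpleRoot_simpleRoot, S.diag]
    ring
  -- Along the string `h_i` has the distinct eigenvalues `a + 2m`, so all components but the `n`-th
  -- lie in other eigenspaces.
  have hsplit : ∀ z ∈ S.stringForm i γ, ∃ z₁ ∈ S.piece (γ + n • simpleRoot i),
      z - z₁ ∈ ⨆ μ : ℂ, ⨆ _ : μ ≠ ((a + 2 * n : ℤ) : ℂ), Module.End.eigenspace D μ := by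
    intro z hz
    rw [stringForm] at hz
    induction hz using AddSubgroup.iSup_induction' with
    | hp m z hz =>
      by_cases hm : m = n
      · subst hm
        exact ⟨z, hz, by simp⟩
      · refine ⟨0, zero_mem _, ?_⟩
        rw [sub_zero]
        refine Submodule.mem_iSup_of_mem ((a + 2 * m : ℤ) : ℂ)
          (Submodule.mem_iSup_of_mem ?_ (heig m z hz))
        intro h
        have := Int.cast_injective h
        omega
    | h1 => exact ⟨0, zero_mem _, by simp⟩
    | hadd z w _ _ ihz ihw =>
      obtain ⟨z₁, hz₁, hz⟩ := ihz
      obtain ⟨w₁, hw₁, hw⟩ := ihw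
      exact ⟨z₁ + w₁, add_mem hz₁ hw₁, by rw [add_sub_add_comm]; exact add_mem hz hw⟩
  -- `y - y₁` lies in the eigenspace of `a + 2n` and in the sum of the others, hence is zero; thus
  -- `y` itself is integral of the right weight.
  obtain ⟨y₁, hy₁, hy₂⟩ := hsplit y hy
  have hyD : y ∈ Module.End.eigenspace D ((a + 2 * n : ℤ) : ℂ) := by
    rw [Module.End.mem_eigenspace_iff, LieAlgebra.ad_apply, h, Int.cast_smul_eq_zsmul]
  have h0 := ((Module.End.eigenspaces_iSupIndep D) ((a + 2 * n : ℤ) : ℂ)).le_bot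
    ⟨sub_mem hyD (heig n y₁ hy₁), hy₂⟩
  rw [sub_eq_zero.mp ((Submodule.mem_bot ℂ).mp h0)]
  exact hy₁

/-- The lift preserves the `α_i`-string and negates `h_i`. It therefore negates the eigenvalue of
`h_i`, and this eigenvalue singles out one piece of the string. -/
lemma refl_mem_piece (i : I) {c : ℤ} (hc : c * c = 1) {γ : I → ℤ} {y : L} (hy : y ∈ S.piece γ) :
    S.refl i c y ∈ S.piece (simpleReflection A i γ) := by
  have hs := S.refl_mem_stringForm i c (S.piece_le_stringForm i γ hy)
  have := S.mem_piece_of_mem_stringForm hs (-dot A γ (simpleRoot i)) ?_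
  · refine S.mem_piece_congr this ?_
    rw [simpleReflection]; module
  · have h1 := S.refl_lie i c (S.piece_le_form _ (S.h_mem i)) (S.piece_le_form γ hy)
    rw [S.refl_h i hc, S.lie_h hy, S.refl_zsmul i c _ (S.piece_le_form γ hy), neg_lie] at h1
    rw [← neg_eq_iff_eq_neg.mpr h1]
    module

end ChevalleySystem

/-! ### Simple reflections on the root lattice -/

section Form

variable {I : Type u} [Fintype I] [DecidableEq I] {A : Matrix I I ℤ}

lemma simpleReflection_simpleReflection (hd : ∀ i, A i i = 2) (i : I) (x : I → ℤ) :
    simpleReflection A i (simpleReflection A i x) = x := by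
  simp only [simpleReflection, dot_sub_left, dot_smul_left, dot_simpleRoot_simpleRoot, hd]
  module

lemma simpleReflection_simpleRoot (hd : ∀ i, A i i = 2) (i : I) :
    simpleReflection A i (simpleRoot i) = -simpleRoot i := by
  rw [simpleReflection, dot_simpleRoot_simpleRoot, hd]; module

lemma dot_simpleReflection (hd : ∀ i, A i i = 2) (hs : ∀ i j, A i j = A j i) (i : I)
    (x y : I → ℤ) : dot A (simpleReflection A i x) (simpleReflection A i y) = dot A x y := by
  simp only [simpleReflection, dot_sub_left, dot_sub_right, dot_smul_left, dot_smul_right,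
    dot_simpleRoot_simpleRoot, hd, dot_comm hs (simpleRoot i) y]
  ring

lemma simpleReflection_apply_of_ne (i : I) {j : I} (h : j ≠ i) (x : I → ℤ) :
    simpleReflection A i x j = x j := by
  simp [simpleReflection, simpleRoot, h]

lemma simpleReflection_add (i : I) (x y : I → ℤ) :
    simpleReflection A i (x + y) = simpleReflection A i x + simpleReflection A i y := by
  simp only [simpleReflection, dot_add_left]; module

lemma simpleReflection_smul (i : I) (c : ℤ) (x : I → ℤ) :
    simpleReflection A i (c • x) = c • simpleReflection A i x := by
  simp only [simpleReflection, dot_smul_left]; module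

lemma simpleRoot_pos (i : I) : (0 : I → ℤ) < simpleRoot i := by
  simp [simpleRoot]

lemma eq_smul_simpleRoot {x : I → ℤ} {i : I} (h : ∀ j, j ≠ i → x j = 0) :
    x = x i • simpleRoot i := by
  ext j
  by_cases hj : j = i
  · subst hj; simp [simpleRoot]
  · simp [simpleRoot, hj, h j hj]

end Form

namespace ChevalleySystem

variable {I : Type u} [Fintype I] [DecidableEq I] {A : Matrix I I ℤ} {L : Type v} [LieRing L]
  [LieAlgebra ℂ L] (S : ChevalleySystem A L)

/-! ### Triangular decomposition -/

/-- Membership in the piece of weight `γ` of the integral span of the iterated brackets of the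
generators with sign `s`. -/
inductive IsPositive (s : Bool) : (I → ℤ) → L → Prop
  | gen (i : I) : IsPositive s (sgn s • simpleRoot i) (S.x s i)
  | lie (i : I) {γ : I → ℤ} {y : L} :
      IsPositive s γ y → IsPositive s (sgn s • simpleRoot i + γ) ⁅S.x s i, y⁆
  | zero (γ : I → ℤ) : IsPositive s γ 0
  | add {γ : I → ℤ} {y z : L} : IsPositive s γ y → IsPositive s γ z → IsPositive s γ (y + z)
  | neg {γ : I → ℤ} {y : L} : IsPositive s γ y → IsPositive s γ (-y)

variable {S}

lemma IsPositive.mem_piece {s : Bool} {γ : I → ℤ} {y : L} (h : S.IsPositive s γ y) :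
    y ∈ S.piece γ := by
  induction h with
  | gen i => exact .gen s i
  | lie i _ ih => exact .lie s i ih
  | zero => exact zero_mem _
  | add _ _ ih₁ ih₂ => exact add_mem ih₁ ih₂
  | neg _ ih => exact neg_mem ih

lemma IsPositive.congr {s : Bool} {γ δ : I → ℤ} {y : L} (h : S.IsPositive s γ y) (e : γ = δ) :
    S.IsPositive s δ y := e ▸ h

lemma IsPositive.zsmul {s : Bool} {γ : I → ℤ} {y : L} (h : S.IsPositive s γ y) (k : ℤ) :
    S.IsPositive s γ (k • y) := by
  induction k with
  | zero => rw [zero_smul]; exact .zero γ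
  | succ n ih => rw [add_smul, one_smul]; exact ih.add h
  | pred n ih => rw [sub_smul, one_smul, sub_eq_add_neg]; exact ih.add h.neg

lemma IsPositive.eq_zero_or {s : Bool} {γ : I → ℤ} {y : L} (h : S.IsPositive s γ y) :
    y = 0 ∨ 0 < sgn s • γ := by
  induction h with
  | gen i => right; rw [smul_smul, sgn_mul_self, one_smul]; exact simpleRoot_pos i
  | lie i _ ih =>
    rcases ih with ih | ih
    · left; rw [ih, lie_zero]
    · right
      rw [smul_add, smul_smul, sgn_mul_self, one_smul]
      exact add_pos (simpleRoot_pos i) ih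
  | zero => exact .inl rfl
  | add _ _ ih₁ ih₂ =>
    rcases ih₁ with h₁ | h₁
    · rcases ih₂ with h₂ | h₂
      · left; rw [h₁, h₂, add_zero]
      · exact .inr h₂
    · exact .inr h₁
  | neg _ ih => exact ih.imp_left fun h => by rw [h, neg_zero]

/-- The weights of the factors cannot cancel, so an iterated bracket whose weight is a multiple of
`α_i` involves only `x s i`; it vanishes once there are two factors. -/
lemma IsPositive.smul_simpleRoot {s : Bool} {i : I} {γ : I → ℤ} {y : L}
    (h : S.IsPositive s γ y) (m : ℤ) (hγ : γ = m • sgn s • simpleRoot i) :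
    ∃ k : ℤ, y = k • S.x s i ∧ (m ≠ 1 → y = 0) := by
  induction h generalizing m with
  | gen j =>
    have h₀ : simpleRoot j = m • (simpleRoot i : I → ℤ) := by
      have := congrArg (sgn s • ·) hγ
      simp only [smul_smul, sgn_mul_self, one_smul] at this
      rw [this]
      linear_combination (norm := module) (sgn_mul_self s) • m • (simpleRoot i : I → ℤ)
    have hj : j = i := by
      by_contra hij
      have := congrFun h₀ j
      simp [simpleRoot, hij] at this
    subst hj
    have hm : m = 1 := by
      have := congrFun h₀ j
      simpa [simpleRoot] using this.symm
    exact ⟨1, (one_smul _ _).symm, fun h => absurd hm h⟩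
  | @lie j γ y hy ih =>
    rcases hy.eq_zero_or with h | h
    · exact ⟨0, by rw [h, lie_zero, zero_smul], fun _ => by rw [h, lie_zero]⟩
    have h₀ : simpleRoot j + sgn s • γ = m • (simpleRoot i : I → ℤ) := by
      have := congrArg (sgn s • ·) hγ
      simp only [smul_add, smul_smul, sgn_mul_self, one_smul] at this
      rw [this]
      linear_combination (norm := module) (sgn_mul_self s) • m • (simpleRoot i : I → ℤ)
    have hj : j = i := by
      by_contra hij
      have h1 := congrFun h₀ j
      have h2 := h.le j
      simp only [simpleRoot, Pi.add_apply, Pi.single_eq_same, Pi.smul_apply,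
        Pi.single_eq_of_ne hij, smul_zero, Pi.zero_apply] at h1 h2
      omega
    subst hj
    have hγ' : γ = (m - 1) • sgn s • simpleRoot j := by
      linear_combination (norm := module) hγ
    obtain ⟨k, hk, -⟩ := ih (m - 1) hγ'
    rw [hk, lie_smul, lie_self, smul_zero]
    exact ⟨0, by rw [zero_smul], fun _ => rfl⟩
  | zero => exact ⟨0, by rw [zero_smul], fun _ => rfl⟩
  | add _ _ ih₁ ih₂ =>
    obtain ⟨k, hk, h₁⟩ := ih₁ m hγ
    obtain ⟨l, hl, h₂⟩ := ih₂ m hγ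
    exact ⟨k + l, by rw [hk, hl, add_smul], fun h => by rw [h₁ h, h₂ h, add_zero]⟩
  | neg _ ih =>
    obtain ⟨k, hk, h₁⟩ := ih m hγ
    exact ⟨-k, by rw [hk, neg_smul], fun h => by rw [h₁ h, neg_zero]⟩

variable (S)

/-- The integral span of the `h_i`. -/
def cartan : AddSubgroup L := AddSubgroup.closure (Set.range S.h)

lemma lie_cartan (s : Bool) (j : I) {c : L} (hc : c ∈ S.cartan) :
    ∃ m : ℤ, ⁅S.x s j, c⁆ = m • S.x s j := by
  induction hc using AddSubgroup.closure_induction with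
  | mem c hc =>
    obtain ⟨i, rfl⟩ := hc
    exact ⟨-(sgn s * A i j), by rw [← lie_skew, S.lie_h_x, neg_smul]⟩
  | zero => exact ⟨0, by simp⟩
  | add y z _ _ hy hz =>
    obtain ⟨m, hm⟩ := hy
    obtain ⟨n, hn⟩ := hz
    exact ⟨m + n, by rw [lie_add, hm, hn, add_smul]⟩
  | neg y _ hy =>
    obtain ⟨m, hm⟩ := hy
    exact ⟨-m, by rw [lie_neg, hm, neg_smul]⟩

lemma lie_x_not_x (s : Bool) (i j : I) :
    ⁅S.x (!s) i, S.x s j⁆ = if i = j then sgn (!s) • S.h i else 0 := by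
  simpa using S.lie_x_x_not (!s) i j

variable {S} in
-- By the Leibniz rule a generator of the opposite sign maps the `s`-part into the `s`-part plus the
-- Cartan part. Recording that the latter occurs only in weight zero keeps the induction going.
lemma IsPositive.lie_not {s : Bool} (i : I) {γ : I → ℤ} {y : L} (h : S.IsPositive s γ y) :
    ∃ a, ∃ c ∈ S.cartan, S.IsPositive s (sgn (!s) • simpleRoot i + γ) a ∧
      (sgn (!s) • simpleRoot i + γ ≠ 0 → c = 0) ∧ ⁅S.x (!s) i, y⁆ = a + c := by
  induction h with
  | gen j =>
    rw [S.lie_x_not_x]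
    refine ⟨0, if i = j then sgn (!s) • S.h i else 0, ?_, .zero _, ?_, (zero_add _).symm⟩
    · split_ifs
      · exact zsmul_mem (AddSubgroup.subset_closure (Set.mem_range_self i)) _
      · exact zero_mem _
    · intro h
      rw [if_neg]
      rintro rfl
      exact h (by rw [sgn_not]; module)
  | @lie j γ y hy ih =>
    obtain ⟨a, c, hc, ha, h0, he⟩ := ih
    rw [leibniz_lie, he, lie_add, S.lie_x_not_x]
    obtain ⟨m, hm⟩ := S.lie_cartan s j hc
    refine ⟨⁅if i = j then sgn (!s) • S.h i else 0, y⁆ + (⁅S.x s j, a⁆ + ⁅S.x s j, c⁆), 0,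
      zero_mem _, .add ?_ (.add ?_ ?_), fun _ => rfl, (add_zero _).symm⟩
    · split_ifs with hij
      · subst hij
        rw [smul_lie, S.lie_h hy.mem_piece]
        exact ((hy.zsmul _).zsmul _).congr (by rw [sgn_not]; module)
      · rw [zero_lie]; exact .zero _
    · exact (ha.lie j).congr (by module)
    -- A nonzero Cartan part forces this weight to be zero; its bracket with `x s j` is then a
    -- multiple of `x s j`, which has the required weight.
    · by_cases h : sgn (!s) • simpleRoot i + γ = 0
      · rw [hm]
        refine ((IsPositive.gen j).zsmul m).congr ?_
        linear_combination (norm := module) -h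
      · rw [h0 h, lie_zero]; exact .zero _
  | zero => exact ⟨0, 0, zero_mem _, .zero _, fun _ => rfl, by simp⟩
  | add _ _ ih₁ ih₂ =>
    obtain ⟨a, c, hc, ha, h0, he⟩ := ih₁
    obtain ⟨a', c', hc', ha', h0', he'⟩ := ih₂
    refine ⟨a + a', c + c', add_mem hc hc', ha.add ha', fun h => ?_, ?_⟩
    · rw [h0 h, h0' h, add_zero]
    · rw [lie_add, he, he']; abel
  | neg _ ih =>
    obtain ⟨a, c, hc, ha, h0, he⟩ := ih
    refine ⟨-a, -c, neg_mem hc, ha.neg, fun h => ?_, ?_⟩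
    · rw [h0 h, neg_zero]
    · rw [lie_neg, he]; abel

/-- The sum of the two halves and the Cartan part is stable under every generator `x t i`. The sign
is left general so that the induction hypothesis can be used with `s = t`; the two halves are
swapped afterwards if necessary. -/
lemma exists_triangular (s : Bool) {γ : I → ℤ} {y : L} (hy : y ∈ S.piece γ) :
    ∃ a b, ∃ c ∈ S.cartan, S.IsPositive s γ a ∧ S.IsPositive (!s) γ b ∧ (γ ≠ 0 → c = 0) ∧
      y = a + b + c := by
  rw [S.mem_piece] at hy
  induction hy generalizing s with
  | gen t i =>
    by_cases h : t = s
    · subst h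
      exact ⟨S.x t i, 0, 0, zero_mem _, .gen i, .zero _, fun _ => rfl, by abel⟩
    · have h' : t = !s := by cases s <;> cases t <;> simp_all
      subst h'
      exact ⟨0, S.x (!s) i, 0, zero_mem _, .zero _, .gen i, fun _ => rfl, by abel⟩
  | @lie t i γ y _ ih =>
    have key : ∃ a b, ∃ c ∈ S.cartan, S.IsPositive t (sgn t • simpleRoot i + γ) a ∧
        S.IsPositive (!t) (sgn t • simpleRoot i + γ) b ∧
        (sgn t • simpleRoot i + γ ≠ 0 → c = 0) ∧ ⁅S.x t i, y⁆ = a + b + c := by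
      obtain ⟨a, b, c, hc, ha, hb, h0, he⟩ := ih t
      obtain ⟨b', c', hc', hb', h0', he'⟩ := hb.lie_not i
      obtain ⟨m, hm⟩ := S.lie_cartan t i hc
      rw [Bool.not_not] at hb' h0' he'
      refine ⟨⁅S.x t i, a⁆ + ⁅S.x t i, c⁆, b', c', hc', (ha.lie i).add ?_, hb', h0', ?_⟩
      · by_cases h : γ = 0
        · rw [hm, h, add_zero]
          exact (IsPositive.gen i).zsmul m
        · rw [h0 h, lie_zero]; exact .zero _
      · rw [he, lie_add, lie_add, he']; abel
    by_cases h : t = s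
    · subst h; exact key
    · have h' : t = !s := by cases s <;> cases t <;> simp_all
      subst h'
      obtain ⟨a, b, c, hc, ha, hb, h0, he⟩ := key
      rw [Bool.not_not] at hb
      exact ⟨b, a, c, hc, hb, ha, h0, by rw [he]; abel⟩
  | zero => exact ⟨0, 0, 0, zero_mem _, .zero _, .zero _, fun _ => rfl, by abel⟩
  | add _ _ ih₁ ih₂ =>
    obtain ⟨a, b, c, hc, ha, hb, h0, he⟩ := ih₁ s
    obtain ⟨a', b', c', hc', ha', hb', h0', he'⟩ := ih₂ s
    refine ⟨a + a', b + b', c + c', add_mem hc hc', ha.add ha', hb.add hb', fun h => ?_, ?_⟩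
    · rw [h0 h, h0' h, add_zero]
    · rw [he, he']; abel
  | neg _ ih =>
    obtain ⟨a, b, c, hc, ha, hb, h0, he⟩ := ih s
    refine ⟨-a, -b, -c, neg_mem hc, ha.neg, hb.neg, fun h => ?_, ?_⟩
    · rw [h0 h, neg_zero]
    · rw [he]; abel

lemma isPositive_of_pos (s : Bool) {γ : I → ℤ} {y : L} (hy : y ∈ S.piece γ)
    (hγ : 0 < sgn s • γ) : S.IsPositive s γ y := by
  obtain ⟨a, b, c, hc, ha, hb, h0, he⟩ := S.exists_triangular s hy
  have hγ0 : γ ≠ 0 := by rintro rfl; simp at hγ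
  rw [h0 hγ0, add_zero] at he
  rcases hb.eq_zero_or with h | h
  · rwa [he, h, add_zero]
  · rw [sgn_not, neg_smul] at h
    exact absurd (hγ.trans (neg_pos.mp h)) (lt_irrefl _)

lemma pos_or_neg_of_mem_piece {γ : I → ℤ} {y : L} (hy : y ∈ S.piece γ) (h : y ≠ 0) (hγ : γ ≠ 0) :
    ∃ s, 0 < sgn s • γ := by
  obtain ⟨a, b, c, hc, ha, hb, h0, he⟩ := S.exists_triangular true hy
  rw [h0 hγ, add_zero] at he
  rcases ha.eq_zero_or with h₁ | h₁
  · rcases hb.eq_zero_or with h₂ | h₂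
    · exact absurd (by rw [he, h₁, h₂, add_zero]) h
    · exact ⟨_, h₂⟩
  · exact ⟨_, h₁⟩

lemma eq_zero_of_mem_piece_smul {i : I} {m : ℤ} (hm₀ : m ≠ 0) (hm : m ≠ 1) (hm' : m ≠ -1) {y : L}
    (hy : y ∈ S.piece (m • simpleRoot i)) : y = 0 := by
  have hs : ∃ s, 0 < sgn s * m := by
    rcases lt_or_gt_of_ne hm₀ with h | h
    · exact ⟨false, by simp [sgn, h]⟩
    · exact ⟨true, by simp [sgn, h]⟩
  obtain ⟨s, hs⟩ := hs
  have hpos : 0 < sgn s • m • (simpleRoot i : I → ℤ) := by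
    rw [smul_smul]
    exact smul_pos hs (simpleRoot_pos i)
  obtain ⟨k, -, h⟩ := (S.isPositive_of_pos s hy hpos).smul_simpleRoot (sgn s * m)
    (by linear_combination (norm := module) -(sgn_mul_self s) • m • (simpleRoot i : I → ℤ))
  apply h
  cases s <;> simp [sgn] <;> omega

lemma exists_eq_smul_of_mem_piece {i : I} {y : L} (hy : y ∈ S.piece (simpleRoot i)) :
    ∃ k : ℤ, y = k • S.x true i := by
  obtain ⟨k, hk, -⟩ := (S.isPositive_of_pos true hy (by
    simpa [sgn] using simpleRoot_pos i)).smul_simpleRoot (i := i) 1 (by simp [sgn])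
  exact ⟨k, hk⟩

/-! ### Weights of norm greater than two -/

lemma refl_refl_neg (i : I) (c : ℤ) {y : L} (hy : y ∈ S.form) :
    S.refl i c (S.refl i (-c) y) = y := by
  simpa using S.refl_neg_refl i (-c) hy

lemma refl_ne_zero (i : I) (c : ℤ) {y : L} (hy : y ∈ S.form) (h : y ≠ 0) :
    S.refl i c y ≠ 0 := fun h' => h (by rw [← S.refl_neg_refl i c hy, h', refl_zero])

/-- Descent on height. A nonzero piece stays nonzero under the reflections, which preserve the norm,
and a suitable one lowers the height. The descent could only stop at a multiple of a simple root,
and there the piece vanishes because the norm is too large. -/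
lemma eq_zero_of_two_lt_dot {γ : I → ℤ} (hγ : 2 < dot A γ γ) {y : L} (hy : y ∈ S.piece γ) :
    y = 0 := by
  suffices H : ∀ n : ℕ, ∀ s γ, ∀ y ∈ S.piece γ, 2 < dot A γ γ → 0 < sgn s • γ →
      ∑ i, sgn s * γ i < n → y = 0 by
    by_contra hy0
    have hγ0 : γ ≠ 0 := by rintro rfl; simp [dot] at hγ
    obtain ⟨s, hs⟩ := S.pos_or_neg_of_mem_piece hy hy0 hγ0
    exact hy0 (H ((∑ i, sgn s * γ i).toNat + 1) s γ y hy hγ hs (by push_cast; omega))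
  intro n
  induction n with
  | zero =>
    intro s γ y _ _ hpos hn
    have : 0 ≤ ∑ i, sgn s * γ i := Finset.sum_nonneg fun i _ => hpos.le i
    push_cast at hn
    omega
  | succ n ih =>
    intro s γ y hy hγ hpos hn
    by_contra hy0
    -- Otherwise every summand of `γ·γ = ∑ γ_i (γ·α_i)` would be nonpositive.
    have hex : ∃ i, 0 < sgn s * γ i ∧ 0 < sgn s * dot A γ (simpleRoot i) := by
      by_contra! hcon
      have : dot A γ γ ≤ 0 := by
        rw [dot_eq_sum_right]
        refine Finset.sum_nonpos fun i _ => ?_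
        have h0 : 0 ≤ sgn s * γ i := hpos.le i
        rcases h0.eq_or_lt with h | h
        · have : γ i = 0 := by
            rcases mul_eq_zero.mp h.symm with h | h
            · exact absurd h (sgn_ne_zero s)
            · exact h
          rw [this, zero_mul]
        · have h' := mul_nonpos_of_nonneg_of_nonpos h0 (hcon i h)
          rwa [mul_mul_mul_comm, sgn_mul_self, one_mul] at h'
      omega
    obtain ⟨i, hi₁, hi₂⟩ := hex
    set k := dot A γ (simpleRoot i) with hk
    have hy' := S.refl_mem_piece i (c := 1) rfl hy
    have hy'0 := S.refl_ne_zero i 1 (S.piece_le_form _ hy) hy0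
    have hγ' : dot A (simpleReflection A i γ) (simpleReflection A i γ) = dot A γ γ :=
      dot_simpleReflection S.diag S.symm i γ γ
    have hne : simpleReflection A i γ ≠ 0 := by
      intro h
      rw [h] at hγ'
      simp [dot] at hγ'
      simp [dot] at hγ
      omega
    obtain ⟨t, ht⟩ := S.pos_or_neg_of_mem_piece hy' hy'0 hne
    by_cases hts : t = s
    · subst hts
      refine hy'0 (ih t _ _ hy' (hγ' ▸ hγ) ht ?_)
      have : ∑ j, sgn t * simpleReflection A i γ j = ∑ j, sgn t * γ j - sgn t * k := by
        simp only [simpleReflection, Pi.sub_apply, Pi.smul_apply, mul_sub, Finset.sum_sub_distrib,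
          simpleRoot, smul_eq_mul]
        congr 1
        rw [Finset.sum_eq_single i (fun j _ hj => by simp [hj]) (by simp)]
        simp [hk, simpleRoot]
      rw [this]
      push_cast at hn
      omega
    -- The reflection changes only the coordinate at `i`. If the sign flips, `γ = mα_i`, and `2m² >
    -- 2` excludes `m = 0, ±1`.
    · have hst : sgn t = -sgn s := by cases s <;> cases t <;> simp_all [sgn]
      have hzero : ∀ j, j ≠ i → γ j = 0 := by
        intro j hj
        have h₁ : 0 ≤ sgn s * γ j := hpos.le j
        have h₂ : 0 ≤ sgn t * simpleReflection A i γ j := ht.le j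
        rw [simpleReflection_apply_of_ne i hj, hst] at h₂
        have h₃ : sgn s * γ j = 0 := by linarith
        exact (mul_eq_zero.mp h₃).resolve_left (sgn_ne_zero s)
      have hm := eq_smul_simpleRoot hzero
      have hnorm : dot A γ γ = 2 * (γ i * γ i) := by
        rw [hm, dot_smul_left, dot_smul_right, dot_simpleRoot_simpleRoot, S.diag]
        simp [simpleRoot]
        ring
      rw [hm] at hy
      refine hy0 (S.eq_zero_of_mem_piece_smul ?_ ?_ ?_ hy) <;> intro h <;> rw [h] at hnorm <;> omega

/-! ### Generators of the pieces -/

/-- `y` generates the piece of weight `γ` of the integral form. -/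
def IsGenerator (γ : I → ℤ) (y : L) : Prop :=
  y ∈ S.piece γ ∧ ∀ z ∈ S.piece γ, ∃ k : ℤ, z = k • y

variable {S}

lemma isGenerator_x (i : I) : S.IsGenerator (simpleRoot i) (S.x true i) :=
  ⟨by simpa [sgn] using S.x_mem true i, fun _ => S.exists_eq_smul_of_mem_piece⟩

lemma IsGenerator.neg {γ : I → ℤ} {y : L} (h : S.IsGenerator γ y) : S.IsGenerator γ (-y) :=
  ⟨neg_mem h.1, fun z hz => (h.2 z hz).imp' (fun k => -k) fun k hk => by simp [hk]⟩

lemma IsGenerator.refl {γ : I → ℤ} {y : L} (h : S.IsGenerator γ y) (i : I) {c : ℤ}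
    (hc : c * c = 1) : S.IsGenerator (simpleReflection A i γ) (S.refl i c y) := by
  refine ⟨S.refl_mem_piece i hc h.1, fun z hz => ?_⟩
  have hz' := S.refl_mem_piece i (c := -c) (by simpa using hc) hz
  rw [simpleReflection_simpleReflection S.diag] at hz'
  obtain ⟨k, hk⟩ := h.2 _ hz'
  refine ⟨k, ?_⟩
  rw [← S.refl_refl_neg i c (S.piece_le_form _ hz), hk, S.refl_zsmul i c k (S.piece_le_form _ h.1)]

/-- The generators are integral multiples of each other. As `y ≠ 0` in a complex vector space, the
two factors have product 1. -/
lemma IsGenerator.eq_or_eq_neg {γ : I → ℤ} {y z : L} (hy : S.IsGenerator γ y)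
    (hz : S.IsGenerator γ z) (h0 : y ≠ 0) : ∃ ε : ℤ, (ε = 1 ∨ ε = -1) ∧ z = ε • y := by
  obtain ⟨k, hk⟩ := hy.2 z hz.1
  obtain ⟨l, hl⟩ := hz.2 y hy.1
  refine ⟨k, ?_, hk⟩
  have : ((l * k - 1 : ℤ) : ℂ) • y = 0 := by
    rw [Int.cast_smul_eq_zsmul, sub_smul, one_smul, mul_smul, ← hk, ← hl, sub_self]
  have h1 : l * k - 1 = 0 := by
    exact_mod_cast (smul_eq_zero.mp this).resolve_right h0
  exact Int.eq_one_or_neg_one_of_mul_eq_one' (by linarith : k * l = 1) |>.imp And.left And.left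

/-- The neighbours `γ - α_i` and `γ + 2α_i` have norm 6, so the string consists of `γ` and `γ +
α_i`. The three exponentials carry `y` to `y + [e_i, y]`, then to `[e_i, y]`, and fix that. -/
lemma refl_eq_lie {i : I} {γ : I → ℤ} {y : L} (hy : y ∈ S.piece γ)
    (h₂ : dot A γ γ = 2) (h : dot A γ (simpleRoot i) = -1) :
    S.refl i 1 y = ⁅S.x true i, y⁆ := by
  have h' : dot A (simpleRoot i) γ = -1 := by rw [S.dot_comm, h]
  have hyp : ∀ s, ⁅S.x s i, y⁆ ∈ S.piece (sgn s • simpleRoot i + γ) := fun s =>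
    S.lie_mem (S.x_mem s i) hy
  have hf : ⁅S.x false i, y⁆ = 0 := by
    refine S.eq_zero_of_two_lt_dot ?_ (hyp false)
    simp [sgn, dot_add_left, dot_add_right, dot_neg_left, dot_neg_right, h, h', h₂,
      dot_simpleRoot_simpleRoot, S.diag]
  have he : ⁅S.x true i, ⁅S.x true i, y⁆⁆ = 0 := by
    refine S.eq_zero_of_two_lt_dot ?_ (S.lie_mem (S.x_mem true i) (hyp true))
    simp [sgn, dot_add_left, dot_add_right, h, h', h₂, dot_simpleRoot_simpleRoot, S.diag]
  have hfe : ⁅S.x false i, ⁅S.x true i, y⁆⁆ = y := by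
    rw [leibniz_lie, hf, lie_zero, add_zero, S.lie_f_e, neg_lie, S.lie_h hy, h]
    module
  have hyf := S.piece_le_form _ hy
  have hef := S.piece_le_form _ (hyp true)
  have h₁ : S.unip true i 1 y = y + ⁅S.x true i, y⁆ := by
    rw [unip, one_smul, lieExp_eq_of_sq he]
  have h₃ : S.unip false i (-1) (y + ⁅S.x true i, y⁆) = ⁅S.x true i, y⁆ := by
    rw [unip, neg_smul, one_smul, lieExp_eq_of_sq] <;>
    simp [hf, hfe]
  rw [ChevalleySystem.refl, h₁, h₃, unip, one_smul, lieExp_eq_of_sq] <;> simp [he]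

end ChevalleySystem

/-! ## A Verma module, and the nonvanishing of the generators -/

namespace ChevalleyGenerators

variable {I : Type u} [DecidableEq I] {A : Matrix I I ℤ} {L : Type v} [LieRing L]
  [LieAlgebra ℂ L] (S : ChevalleyGenerators A L)

lemma lie_x_h (s : Bool) (i j : I) : ⁅S.x s i, S.h j⁆ = -((sgn s * A j i) • S.x s i) := by
  rw [← lie_skew, S.lie_h_x]

lemma lie_x_not_x (s : Bool) (i j : I) :
    ⁅S.x (!s) i, S.x s j⁆ = if i = j then sgn (!s) • S.h i else 0 := by
  simpa using S.lie_x_x_not (!s) i j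

/-- The left side of the Serre relation of two different nodes. -/
def serre (s : Bool) (i j : I) : L :=
  if A i j = 0 then ⁅S.x s i, S.x s j⁆ else ⁅S.x s i, ⁅S.x s i, S.x s j⁆⁆

lemma lie_h_serre (s : Bool) (i j k : I) : ∃ c : ℤ, ⁅S.h k, S.serre s i j⁆ = c • S.serre s i j := by
  rw [serre]
  split_ifs
  · exact ⟨sgn s * A k i + sgn s * A k j, by
      rw [leibniz_lie, S.lie_h_x, S.lie_h_x, smul_lie, lie_smul]; module⟩
  · exact ⟨sgn s * A k i + (sgn s * A k i + sgn s * A k j), by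
      rw [leibniz_lie, leibniz_lie (S.h k), S.lie_h_x, S.lie_h_x, lie_add]
      simp only [smul_lie, lie_smul]; module⟩

/-- This needs only the Chevalley relations. When `A i j = -1` and `k = i`, the two multiples of
`[x_i, x_j]` coming from `h_i` cancel. -/
lemma lie_x_not_serre (s : Bool) {i j : I} (hij : i ≠ j) (k : I) :
    ⁅S.x (!s) k, S.serre s i j⁆ = 0 := by
  have h₁ : ⁅S.x (!s) k, ⁅S.x s i, S.x s j⁆⁆ =
      (if k = i then -A i j else 0) • S.x s j + (if k = j then A i j else 0) • S.x s i := by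
    rw [leibniz_lie, S.lie_x_not_x, S.lie_x_not_x]
    congr 1
    · split_ifs with h
      · subst h
        rw [smul_lie, S.lie_h_x, sgn_not]
        linear_combination (norm := module) (-A k j) • (sgn_mul_self s) • S.x s j
      · simp
    · split_ifs with h
      · subst h
        rw [lie_smul, S.lie_x_h, sgn_not, S.symm k i]
        linear_combination (norm := module) (A i k) • (sgn_mul_self s) • S.x s i
      · simp
  rw [serre]
  split_ifs with h
  · rw [h₁, h]; simp
  · have hA := (S.off_diag i j hij).resolve_left h
    rw [leibniz_lie, h₁, S.lie_x_not_x, hA]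
    by_cases hk : k = i
    · subst hk
      simp only [if_pos, if_neg hij]
      rw [smul_lie, leibniz_lie, S.lie_h_x, S.lie_h_x, S.diag, hA, sgn_not]
      simp only [smul_lie, lie_smul, zero_smul, add_zero]
      linear_combination (norm := module) (-1 : ℤ) • (sgn_mul_self s) • ⁅S.x s k, S.x s j⁆
    · by_cases hk' : k = j
      · subst hk'; simp [hk]
      · simp [hk, hk']

end ChevalleyGenerators

attribute [local instance] LieRing.ofAssociativeRing

namespace Verma

variable {I : Type u} [DecidableEq I] (A : Matrix I I ℤ)

/-- The space with basis the words in the lowering generators. -/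
def Words (I : Type u) : Type u := List I →₀ ℂ

instance : AddCommGroup (Words I) := inferInstanceAs (AddCommGroup (List I →₀ ℂ))

instance : Module ℂ (Words I) := inferInstanceAs (Module ℂ (List I →₀ ℂ))

/-- The basis vector of a word. -/
def word (w : List I) : Words I := Finsupp.single w (1 : ℂ)

section Lift

variable {V : Type*} [AddCommGroup V] [Module ℂ V]

/-- The linear map with given values on the words. -/
def wordLift (f : List I → V) : Words I →ₗ[ℂ] V :=
  Finsupp.linearCombination (M := V) ℂ f

@[simp] lemma wordLift_word (f : List I → V) (w : List I) : wordLift f (word w) = f w := by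
  exact (Finsupp.linearCombination_single ℂ (1 : ℂ) w (v := f)).trans (one_smul _ _)

lemma op_ext {f g : Words I →ₗ[ℂ] V} (h : ∀ w, f (word w) = g (word w)) : f = g :=
  Finsupp.lhom_ext' (M := ℂ) fun w => LinearMap.ext_ring (h w)

end Lift

/-- The lowering operator of a node. -/
def opF (j : I) : Module.End ℂ (Words I) := wordLift fun w => word (j :: w)

/-- The weight of a word with respect to a node. -/
def wordWeight (k : I) (w : List I) : ℤ := 1 - (w.map fun j => A k j).sum

/-- The diagonal operator of a node. -/
def opH (k : I) : Module.End ℂ (Words I) :=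
  wordLift fun w => wordWeight A k w • word w

/-- The image of a word under the raising operator of a node. -/
def raise (k : I) : List I → Words I
  | [] => 0
  | j :: w => opF j (raise k w) + if k = j then wordWeight A k w • word w else 0

/-- The raising operator of a node. -/
def opE (k : I) : Module.End ℂ (Words I) := wordLift (raise A k)

@[simp] lemma opF_word (j : I) (w : List I) : opF j (word w) = word (j :: w) := by simp [opF]

@[simp] lemma opH_word (k : I) (w : List I) : opH A k (word w) = wordWeight A k w • word w := by
  simp [opH]

@[simp] lemma opE_word_nil (k : I) : opE A k (word []) = 0 := by simp [opE, raise]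

@[simp] lemma opE_word_cons (k j : I) (w : List I) : opE A k (word (j :: w)) =
    opF j (opE A k (word w)) + if k = j then wordWeight A k w • word w else 0 := by
  simp [opE, raise]

lemma wordWeight_cons (k j : I) (w : List I) :
    wordWeight A k (j :: w) = wordWeight A k w - A k j := by
  simp [wordWeight]; ring

lemma lie_opH_opH (i j : I) : ⁅opH A i, opH A j⁆ = 0 := by
  refine op_ext fun w => ?_
  simp only [Ring.lie_def, LinearMap.sub_apply, Module.End.mul_apply, opH_word, map_zsmul,
    LinearMap.zero_apply]
  module

lemma lie_opH_opF (i j : I) : ⁅opH A i, opF j⁆ = (-A i j) • opF j := by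
  refine op_ext fun w => ?_
  simp only [Ring.lie_def, LinearMap.sub_apply, Module.End.mul_apply, opH_word, map_zsmul,
    LinearMap.smul_apply, opF_word, wordWeight_cons]
  module

/-- Holds by construction: the recursion defining `raise` is this commutation rule. -/
lemma lie_opE_opF (i j : I) : ⁅opE A i, opF j⁆ = if i = j then opH A i else 0 := by
  refine op_ext fun w => ?_
  simp only [Ring.lie_def, LinearMap.sub_apply, Module.End.mul_apply, opF_word, opE_word_cons]
  split_ifs <;> simp

lemma lie_opH_opE (i j : I) : ⁅opH A i, opE A j⁆ = A i j • opE A j := by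
  refine op_ext fun w => ?_
  simp only [Ring.lie_def, LinearMap.sub_apply, Module.End.mul_apply, opH_word, map_zsmul,
    LinearMap.smul_apply]
  induction w with
  | nil => simp
  | cons k w ih =>
    have hHF : ∀ v, opH A i (opF k v) = opF k (opH A i v) - A i k • opF k v := fun v => by
      have := LinearMap.congr_fun (lie_opH_opF A i k) v
      simp only [Ring.lie_def, LinearMap.sub_apply, Module.End.mul_apply,
        LinearMap.smul_apply] at this
      rw [sub_eq_iff_eq_add] at this
      rw [this]; module
    have ih' := congrArg (opF k) ih
    simp only [map_sub, map_zsmul] at ih'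
    rw [opE_word_cons, map_add, hHF, wordWeight_cons]
    by_cases hjk : j = k
    · subst hjk
      simp only [if_pos, map_zsmul, opH_word]
      linear_combination (norm := module) ih'
    · simp only [if_neg hjk, map_zero]
      linear_combination (norm := module) ih'

variable {A}

/-- The raising, lowering and diagonal operators satisfy the Chevalley relations. -/
def generators (hd : ∀ i, A i i = 2) (hs : ∀ i j, A i j = A j i)
    (ho : ∀ i j, i ≠ j → A i j = 0 ∨ A i j = -1) :
    ChevalleyGenerators A (Module.End ℂ (Words I)) where
  x s i := if s then opE A i else opF i
  h := opH A
  diag := hd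
  symm := hs
  off_diag := ho
  lie_h_h := lie_opH_opH A
  lie_h_x s i j := by
    cases s
    · simpa only [sgn, Bool.false_eq_true, if_false, neg_one_mul] using lie_opH_opF A i j
    · simpa [sgn] using lie_opH_opE A i j
  lie_x_x_not s i j := by
    cases s
    · simp only [sgn, Bool.not_false, if_true, Bool.false_eq_true, if_false]
      rw [← lie_skew, lie_opE_opF]
      by_cases h : j = i
      · subst h; simp
      · simp [h, Ne.symm h]
    · simpa [sgn] using lie_opE_opF A i j

/-! ### Imposing the Serre relations on the lowering operators -/

variable (S : ChevalleyGenerators A (Module.End ℂ (Words I)))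

/-- The submodule generated by the Serre elements in the lowering operators. -/
inductive Relator : Words I → Prop
  | serre (i j : I) (hij : i ≠ j) (v : Words I) : Relator (S.serre false i j v)
  | lower (k : I) (v : Words I) (h : Relator v) : Relator (S.x false k v)

/-- The submodule spanned by the relators. -/
def relations : Submodule ℂ (Words I) := Submodule.span ℂ {v | Relator S v}

lemma serre_mem (i j : I) (hij : i ≠ j) (v : Words I) : S.serre false i j v ∈ relations S :=
  Submodule.subset_span (.serre i j hij v)

lemma lower_mem (k : I) {v : Words I} (hv : v ∈ relations S) : S.x false k v ∈ relations S := by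
  refine Submodule.span_induction (p := fun v _ => S.x false k v ∈ relations S) ?_ ?_ ?_ ?_ hv
  · exact fun v hv => Submodule.subset_span (Relator.lower k v hv)
  · simp
  · intro v w _ _ h h'; rw [map_add]; exact add_mem h h'
  · intro c v _ h; rw [map_smul]; exact Submodule.smul_mem _ _ h

lemma lie_apply_eq {V : Type*} [AddCommGroup V] [Module ℂ V] (f g : Module.End ℂ V) (v : V) :
    f (g v) = g (f v) + ⁅f, g⁆ v := by
  simp [Ring.lie_def]

lemma diag_mem (k : I) {v : Words I} (hv : v ∈ relations S) : S.h k v ∈ relations S := by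
  refine Submodule.span_induction (p := fun v _ => S.h k v ∈ relations S) ?_ ?_ ?_ ?_ hv
  · intro v hv
    induction hv with
    | serre i j hij v =>
      obtain ⟨c, hc⟩ := S.lie_h_serre false i j k
      rw [lie_apply_eq, hc, LinearMap.smul_apply]
      exact add_mem (serre_mem S i j hij _) (zsmul_mem (serre_mem S i j hij _) _)
    | lower l v h ih =>
      rw [lie_apply_eq, S.lie_h_x, LinearMap.smul_apply]
      exact add_mem (lower_mem S l ih)
        (zsmul_mem (lower_mem S l (Submodule.subset_span h)) _)
  · simp
  · intro v w _ _ h h'; rw [map_add]; exact add_mem h h'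
  · intro c v _ h; rw [map_smul]; exact Submodule.smul_mem _ _ h

/-- Raising operators commute with the lowering Serre elements, and their commutators with lowering
operators are diagonal; both facts preserve the span of the relators. -/
lemma raise_mem (k : I) {v : Words I} (hv : v ∈ relations S) : S.x true k v ∈ relations S := by
  refine Submodule.span_induction (p := fun v _ => S.x true k v ∈ relations S) ?_ ?_ ?_ ?_ hv
  · intro v hv
    induction hv with
    | serre i j hij v =>
      rw [lie_apply_eq, show ⁅S.x true k, S.serre false i j⁆ = 0 from
        S.lie_x_not_serre false hij k, LinearMap.zero_apply, add_zero]
      exact serre_mem S i j hij _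
    | lower l v h ih =>
      rw [lie_apply_eq, show ⁅S.x true k, S.x false l⁆ = _ from S.lie_x_x_not true k l]
      refine add_mem (lower_mem S l ih) ?_
      split_ifs
      · exact zsmul_mem (diag_mem S k (Submodule.subset_span h)) _
      · exact zero_mem _
  · simp
  · intro v w _ _ h h'; rw [map_add]; exact add_mem h h'
  · intro c v _ h; rw [map_smul]; exact Submodule.smul_mem _ _ h

lemma x_mem (s : Bool) (k : I) : relations S ≤ (relations S).comap (S.x s k) := by
  intro v hv
  cases s
  · exact lower_mem S k hv
  · exact raise_mem S k hv

lemma mapQ_lie {V : Type*} [AddCommGroup V] [Module ℂ V] (N : Submodule ℂ V)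
    {f g k : Module.End ℂ V} (hf : N ≤ N.comap f) (hg : N ≤ N.comap g) (hk : N ≤ N.comap k)
    (h : ⁅f, g⁆ = k) : ⁅(N.mapQ N f hf : Module.End ℂ (V ⧸ N)), N.mapQ N g hg⁆ = N.mapQ N k hk := by
  subst h
  refine Submodule.linearMap_qext _ (LinearMap.ext fun v => ?_)
  simp [Ring.lie_def]

lemma le_comap_smul {V : Type*} [AddCommGroup V] [Module ℂ V] {N : Submodule ℂ V}
    {f : Module.End ℂ V} (hf : N ≤ N.comap f) (c : ℤ) : N ≤ N.comap (c • f) := fun v hv => by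
  rw [Submodule.mem_comap, LinearMap.smul_apply]
  exact zsmul_mem (show f v ∈ N from hf hv) c

lemma mapQ_zsmul {V : Type*} [AddCommGroup V] [Module ℂ V] (N : Submodule ℂ V)
    {f : Module.End ℂ V} (hf : N ≤ N.comap f) (c : ℤ) :
    N.mapQ N (c • f) (le_comap_smul hf c) = c • N.mapQ N f hf := by
  refine Submodule.linearMap_qext _ (LinearMap.ext fun v => ?_)
  simp

lemma le_comap_lie {V : Type*} [AddCommGroup V] [Module ℂ V] {N : Submodule ℂ V}
    {f g : Module.End ℂ V} (hf : N ≤ N.comap f) (hg : N ≤ N.comap g) : N ≤ N.comap ⁅f, g⁆ :=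
  fun v hv => by
    rw [Submodule.mem_comap, Ring.lie_def, LinearMap.sub_apply]
    exact sub_mem (hf (hg hv)) (hg (hf hv))

lemma mapQ_eq_zero {V : Type*} [AddCommGroup V] [Module ℂ V] {N : Submodule ℂ V}
    {f : Module.End ℂ V} (hf : N ≤ N.comap f) (h : ∀ v, f v ∈ N) : N.mapQ N f hf = 0 := by
  refine Submodule.linearMap_qext _ (LinearMap.ext fun v => ?_)
  simpa using h v

/-- The operators on the Verma module `Words I ⧸ relations S`. -/
def system (hserre : ∀ s i j, i ≠ j → ∀ v, S.serre s i j v ∈ relations S) :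
    ChevalleySystem A (Module.End ℂ (Words I ⧸ relations S)) where
  x s i := (relations S).mapQ _ (S.x s i) (x_mem S s i)
  h i := (relations S).mapQ _ (S.h i) fun _ => diag_mem S i
  diag := S.diag
  symm := S.symm
  off_diag := S.off_diag
  lie_h_h i j := by
    rw [mapQ_lie _ _ _ (by rw [S.lie_h_h, Submodule.comap_zero]; exact le_top) rfl]
    exact mapQ_eq_zero _ fun v => by simp [S.lie_h_h]
  lie_h_x s i j := by
    rw [mapQ_lie _ _ _ (le_comap_smul (x_mem S s j) _) (S.lie_h_x s i j), mapQ_zsmul]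
  lie_x_x_not s i j := by
    split_ifs with h
    · subst h
      rw [mapQ_lie _ _ _ (le_comap_smul (fun _ => diag_mem S i) _)
        (by simpa using S.lie_x_x_not s i i), mapQ_zsmul]
    · have h0 : ⁅S.x s i, S.x (!s) j⁆ = 0 := by simp [S.lie_x_x_not, h]
      rw [mapQ_lie _ _ _ (by rw [h0, Submodule.comap_zero]; exact le_top) rfl]
      exact mapQ_eq_zero _ fun v => by simp [h0]
  serre_zero s i j hij h := by
    rw [mapQ_lie _ _ _ (le_comap_lie (x_mem S s i) (x_mem S s j)) rfl]
    exact mapQ_eq_zero _ fun v => by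
      simpa only [ChevalleyGenerators.serre, h, if_true] using hserre s i j hij v
  serre_neg_one s i j h := by
    have hij : i ≠ j := by rintro rfl; simp [S.diag] at h
    have h₁ := le_comap_lie (x_mem S s i) (x_mem S s j)
    rw [mapQ_lie _ (x_mem S s i) (x_mem S s j) h₁ rfl,
      mapQ_lie _ _ _ (le_comap_lie (x_mem S s i) h₁) rfl]
    exact mapQ_eq_zero _ fun v => by
      have hA : A i j ≠ 0 := by rw [h]; decide
      simpa only [ChevalleyGenerators.serre, if_neg hA] using hserre s i j hij v

/-! ### Raising Serre relations and survival of the vacuum -/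

variable (hd : ∀ i, A i i = 2) (hs : ∀ i j, A i j = A j i)
    (ho : ∀ i j, i ≠ j → A i j = 0 ∨ A i j = -1)

/-- A raising Serre element kills the empty word and commutes with the lowering operators, which
create all other words from it. No quotient is needed for these relations. -/
lemma serre_true_eq_zero {i j : I} (hij : i ≠ j) :
    (generators hd hs ho).serre true i j = 0 := by
  set S := generators hd hs ho
  refine op_ext fun w => ?_
  induction w with
  | nil =>
    have hE : ∀ k, S.x true k (word []) = 0 := fun k => opE_word_nil A k
    rw [ChevalleyGenerators.serre]
    split_ifs <;> simp [Ring.lie_def, hE]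
  | cons k w ih =>
    have hF : S.x false k (word w) = word (k :: w) := opF_word k w
    have h0 : ⁅S.x false k, S.serre true i j⁆ = 0 := S.lie_x_not_serre true hij k
    have := lie_apply_eq (S.x false k) (S.serre true i j) (word w)
    rw [h0, ih, hF] at this
    simpa using this.symm

/-- The coefficient of the empty word. -/
def vacuum : Words I →ₗ[ℂ] ℂ := wordLift fun w => if w = [] then 1 else 0

/-- Every relator is a sum of images of lowering operators, and these produce only nonempty words.
So the empty word survives in the quotient. -/
lemma vacuum_eq_zero_of_mem {v : Words I} (hv : v ∈ relations (generators hd hs ho)) :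
    vacuum v = 0 := by
  set S := generators hd hs ho
  have hF : ∀ k (v : Words I), vacuum (S.x false k v) = 0 := fun k v => by
    have : vacuum ∘ₗ S.x false k = (0 : Words I →ₗ[ℂ] ℂ) :=
      op_ext fun w => by
        have : S.x false k (word w) = word (k :: w) := opF_word k w
        simp [this, vacuum]
    exact LinearMap.congr_fun this v
  refine Submodule.span_induction (p := fun v _ => vacuum v = 0) ?_ ?_ ?_ ?_ hv
  · intro v hv
    cases hv with
    | serre i j hij v =>
      rw [ChevalleyGenerators.serre]
      split_ifs <;> simp [Ring.lie_def, hF]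
    | lower k v h => exact hF _ _
  · simp
  · intro v w _ _ h h'; simp [h, h']
  · intro c v _ h; simp [h]

/-- The operators on the Verma module. -/
def vermaSystem : ChevalleySystem A
    (Module.End ℂ (Words I ⧸ relations (generators hd hs ho))) :=
  system _ fun s i j hij v => by
    cases s
    · exact serre_mem _ i j hij v
    · rw [serre_true_eq_zero hd hs ho hij]; exact zero_mem _

/-- If `e_i` acted as zero, so would `h_i = [e_i, f_i]`. But `h_i` fixes the highest weight vector,
the highest weight having been chosen to be 1 at every node. -/
lemma vermaSystem_x_true_ne_zero (i : I) : (vermaSystem hd hs ho).x true i ≠ 0 := by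
  intro h
  have h' := (vermaSystem hd hs ho).lie_x_x_not true i i
  rw [h, zero_lie, if_pos rfl, sgn, if_pos rfl, one_smul] at h'
  have h₁ := LinearMap.congr_fun h' (Submodule.Quotient.mk (word []))
  have h₂ : opH A i (word []) ∈ relations (generators hd hs ho) := by
    rw [← Submodule.Quotient.mk_eq_zero]
    exact h₁.symm
  have h₃ := vacuum_eq_zero_of_mem hd hs ho h₂
  rw [opH_word] at h₃
  simp [wordWeight, vacuum] at h₃

end Verma

/-! ## The Kac–Moody algebra as a system of Chevalley generators -/

lemma IsGCM.symm_of_isSimplyLaced {I : Type u} {A : Matrix I I ℤ} (hA : IsGCM A)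
    (hsl : A.IsSimplyLaced) (i j : I) : A i j = A j i := by
  by_cases hij : i = j
  · rw [hij]
  rcases hsl hij with h | h
  · rw [h, hA.zero_symm i j h]
  · rcases hsl (Ne.symm hij) with h' | h'
    · rw [h', hA.zero_symm j i h']
    · rw [h, h']

section Alg

open CartanMatrix

variable {I : Type u} [Fintype I] [DecidableEq I] (A : Matrix I I ℤ)

/-- The quotient map from the free Lie algebra onto the Kac–Moody algebra. -/
def toAlg : FreeLieAlgebra ℂ (Generators I) →ₗ⁅ℂ⁆ Alg A where
  toFun y := LieSubmodule.Quotient.mk (N := Relations.toIdeal ℂ A) y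
  map_add' _ _ := rfl
  map_smul' _ _ := rfl
  map_lie' := rfl

lemma toAlg_eq_zero_iff (y : FreeLieAlgebra ℂ (Generators I)) :
    toAlg A y = 0 ↔ y ∈ Relations.toIdeal ℂ A :=
  LieSubmodule.Quotient.mk_eq_zero'

lemma toAlg_eq_zero {y : FreeLieAlgebra ℂ (Generators I)} (h : y ∈ Relations.toSet ℂ A) :
    toAlg A y = 0 :=
  (toAlg_eq_zero_iff A y).mpr (LieSubmodule.subset_lieSpan h)

/-- The generator `h_i`. -/
def genH (i : I) : Alg A := toAlg A (FreeLieAlgebra.of ℂ (Generators.H i))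

lemma toAlg_of_E (i : I) : toAlg A (FreeLieAlgebra.of ℂ (Generators.E i)) = genE A i := rfl

lemma toAlg_of_F (i : I) : toAlg A (FreeLieAlgebra.of ℂ (Generators.F i)) = genF A i := rfl

lemma toAlg_of_H (i : I) : toAlg A (FreeLieAlgebra.of ℂ (Generators.H i)) = genH A i := rfl

lemma lie_genH_genH (i j : I) : ⁅genH A i, genH A j⁆ = 0 := by
  have := toAlg_eq_zero A (y := Relations.HH ℂ (i, j)) (by simp [Relations.toSet])
  simpa [Relations.HH, toAlg_of_H] using this

lemma lie_genE_genF (i j : I) : ⁅genE A i, genF A j⁆ = if i = j then genH A i else 0 := by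
  have := toAlg_eq_zero A (y := Relations.EF ℂ (i, j)) (by simp [Relations.toSet])
  simp only [Relations.EF, Function.uncurry_apply_pair, Function.comp_apply] at this
  split_ifs with h
  · rw [if_pos h, map_sub, LieHom.map_lie, toAlg_of_E, toAlg_of_F, toAlg_of_H] at this
    subst h
    exact sub_eq_zero.mp this
  · rw [if_neg h, LieHom.map_lie, toAlg_of_E, toAlg_of_F] at this
    exact this

lemma lie_genH_genE (i j : I) : ⁅genH A i, genE A j⁆ = A i j • genE A j := by
  have := toAlg_eq_zero A (y := Relations.HE ℂ A (i, j)) (by simp [Relations.toSet])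
  simp only [Relations.HE, Function.uncurry_apply_pair, Function.comp_apply] at this
  rw [map_sub, LieHom.map_lie, map_zsmul, toAlg_of_E, toAlg_of_H] at this
  exact sub_eq_zero.mp this

lemma lie_genH_genF (i j : I) : ⁅genH A i, genF A j⁆ = -(A i j • genF A j) := by
  have := toAlg_eq_zero A (y := Relations.HF ℂ A (i, j)) (by simp [Relations.toSet])
  simp only [Relations.HF, Function.uncurry_apply_pair, Function.comp_apply] at this
  rw [map_add, LieHom.map_lie, map_zsmul, toAlg_of_F, toAlg_of_H] at this
  exact eq_neg_of_add_eq_zero_left this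

lemma lie_genE_genE {i j : I} (h : A i j = 0) : ⁅genE A i, genE A j⁆ = 0 := by
  have := toAlg_eq_zero A (y := Relations.adE ℂ A (i, j)) (by simp [Relations.toSet])
  simpa [Relations.adE, h, toAlg_of_E] using this

lemma lie_genF_genF {i j : I} (h : A i j = 0) : ⁅genF A i, genF A j⁆ = 0 := by
  have := toAlg_eq_zero A (y := Relations.adF ℂ A (i, j)) (by simp [Relations.toSet])
  simpa [Relations.adF, h, toAlg_of_F] using this

lemma lie_lie_genE_genE {i j : I} (h : A i j = -1) : ⁅genE A i, ⁅genE A i, genE A j⁆⁆ = 0 := by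
  have := toAlg_eq_zero A (y := Relations.adE ℂ A (i, j)) (by simp [Relations.toSet])
  simpa [Relations.adE, h, toAlg_of_E] using this

lemma lie_lie_genF_genF {i j : I} (h : A i j = -1) : ⁅genF A i, ⁅genF A i, genF A j⁆⁆ = 0 := by
  have := toAlg_eq_zero A (y := Relations.adF ℂ A (i, j)) (by simp [Relations.toSet])
  simpa [Relations.adF, h, toAlg_of_F] using this

variable {A}

/-- The Chevalley generators of the Kac–Moody algebra. -/
def algSystem (hA : IsGCM A) (hsl : A.IsSimplyLaced) : ChevalleySystem A (Alg A) where
  x s i := if s then genE A i else genF A i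
  h := genH A
  diag := hA.diag
  symm := hA.symm_of_isSimplyLaced hsl
  off_diag _ _ h := hsl h
  lie_h_h := lie_genH_genH A
  lie_h_x s i j := by
    cases s
    · simpa [sgn] using lie_genH_genF A i j
    · simpa [sgn] using lie_genH_genE A i j
  lie_x_x_not s i j := by
    cases s
    · simp only [sgn, Bool.not_false, if_true, Bool.false_eq_true, if_false]
      rw [← lie_skew, lie_genE_genF]
      by_cases h : j = i
      · subst h; simp
      · simp [h, Ne.symm h]
    · simpa [sgn] using lie_genE_genF A i j
  serre_zero s i j _ h := by
    cases s
    · simpa using lie_genF_genF A h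
    · simpa using lie_genE_genE A h
  serre_neg_one s i j h := by
    cases s
    · simpa using lie_lie_genF_genF A h
    · simpa using lie_lie_genE_genE A h

/-- A homomorphism out of the free Lie algebra determined by a system of Chevalley generators. -/
def ChevalleySystem.freeHom {L : Type v} [LieRing L] [LieAlgebra ℂ L] (S : ChevalleySystem A L) :
    FreeLieAlgebra ℂ (Generators I) →ₗ⁅ℂ⁆ L :=
  FreeLieAlgebra.lift ℂ fun
    | .E i => S.x true i
    | .F i => S.x false i
    | .H i => S.h i

lemma ChevalleySystem.freeHom_eq_zero {L : Type v} [LieRing L] [LieAlgebra ℂ L]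
    (S : ChevalleySystem A L) {y : FreeLieAlgebra ℂ (Generators I)}
    (hy : y ∈ Relations.toIdeal ℂ A) : S.freeHom y = 0 := by
  have hE : ∀ i, S.freeHom (FreeLieAlgebra.of ℂ (.E i)) = S.x true i := fun i => by
    simp [freeHom]
  have hF : ∀ i, S.freeHom (FreeLieAlgebra.of ℂ (.F i)) = S.x false i := fun i => by
    simp [freeHom]
  have hH : ∀ i, S.freeHom (FreeLieAlgebra.of ℂ (.H i)) = S.h i := fun i => by
    simp [freeHom]
  suffices h : Relations.toIdeal ℂ A ≤ S.freeHom.ker from h hy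
  refine LieSubmodule.lieSpan_le.mpr fun z hz => ?_
  change S.freeHom z = 0
  -- The power counts the brackets beyond the inner one, so there are `1 - A i j` in total. The case
  -- `i = j` is trivial because the inner bracket is zero.
  have serre : ∀ s i j, ((LieAlgebra.ad ℂ L (S.x s i)) ^ (-A i j).toNat) ⁅S.x s i, S.x s j⁆ = 0 := by
    intro s i j
    by_cases hij : i = j
    · simp [hij]
    · rcases S.off_diag i j hij with h | h
      · simp [h, S.serre_zero s i j hij h]
      · simp [h, S.serre_neg_one s i j h]
  have had : ∀ (y z : FreeLieAlgebra ℂ (Generators I)) (n : ℕ),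
      S.freeHom (((LieAlgebra.ad ℂ _ y) ^ n) z) =
        ((LieAlgebra.ad ℂ L (S.freeHom y)) ^ n) (S.freeHom z) := by
    intro y z n
    induction n with
    | zero => simp
    | succ n ih => rw [pow_succ', pow_succ', Module.End.mul_apply, Module.End.mul_apply, ← ih,
        LieAlgebra.ad_apply, LieAlgebra.ad_apply, LieHom.map_lie]
  rcases hz with ((((⟨⟨i, j⟩, rfl⟩ | ⟨⟨i, j⟩, rfl⟩) | ⟨⟨i, j⟩, rfl⟩) | ⟨⟨i, j⟩, rfl⟩) |
    ⟨⟨i, j⟩, rfl⟩) | ⟨⟨i, j⟩, rfl⟩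
  · simp [Relations.HH, hH, S.lie_h_h]
  · have := S.lie_x_x_not true i j
    simp only [Bool.not_true, sgn, if_true, one_smul] at this
    simp only [Relations.EF, Function.uncurry_apply_pair, Function.comp_apply]
    split_ifs with h
    · subst h; simp [hE, hF, hH, this]
    · simp [hE, hF, this, h]
  · have := S.lie_h_x true i j
    simp only [sgn, if_true, one_mul] at this
    simp only [Relations.HE, Function.uncurry_apply_pair, Function.comp_apply]
    rw [map_sub, LieHom.map_lie, map_zsmul, hE, hH, this, sub_self]
  · have := S.lie_h_x false i j
    simp only [sgn, Bool.false_eq_true, if_false, neg_one_mul, neg_smul] at this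
    simp only [Relations.HF, Function.uncurry_apply_pair, Function.comp_apply]
    rw [map_add, LieHom.map_lie, map_zsmul, hF, hH, this, neg_add_cancel]
  · simp only [Relations.adE, Function.uncurry_apply_pair, Function.comp_apply]
    rw [had, LieHom.map_lie, hE, hE, serre]
  · simp only [Relations.adF, Function.uncurry_apply_pair, Function.comp_apply]
    rw [had, LieHom.map_lie, hF, hF, serre]

variable (hA : IsGCM A) (hsl : A.IsSimplyLaced)

lemma genE_ne_zero (hA : IsGCM A) (hsl : A.IsSimplyLaced) (i : I) : genE A i ≠ 0 := by
  intro h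
  rw [← toAlg_of_E, toAlg_eq_zero_iff] at h
  have hs := hA.symm_of_isSimplyLaced hsl
  have := (Verma.vermaSystem hA.diag hs fun _ _ h => hsl h).freeHom_eq_zero h
  rw [ChevalleySystem.freeHom, FreeLieAlgebra.lift_of_apply] at this
  exact Verma.vermaSystem_x_true_ne_zero hA.diag hs _ i this

/-! ## Root vectors -/

lemma starReflection_eq (i : I) (y : Alg A) :
    starReflection A i y = (algSystem hA hsl).refl i 1 y := by
  have h (u y : Alg A) : expAd A u y = lieExp u y := rfl
  simp [starReflection, ChevalleySystem.refl, ChevalleySystem.unip, h, algSystem]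

variable {hA hsl} in
lemma IsRootVector.isGenerator {γ : I → ℤ} {y : Alg A} (h : IsRootVector A γ y) :
    (algSystem hA hsl).IsGenerator γ y := by
  induction h with
  | simple i => exact ChevalleySystem.isGenerator_x i
  | neg _ ih => exact ih.neg
  | reflect i _ ih =>
    rw [starReflection_eq hA hsl]
    exact ih.refl i rfl

lemma IsRootVector.ne_zero (hA : IsGCM A) (hsl : A.IsSimplyLaced) {γ : I → ℤ} {y : Alg A}
    (h : IsRootVector A γ y) : y ≠ 0 := by
  induction h with
  | simple i => exact genE_ne_zero hA hsl i
  | neg _ ih => exact neg_ne_zero.mpr ih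
  | @reflect i γ y h ih =>
    rw [starReflection_eq hA hsl]
    exact (algSystem hA hsl).refl_ne_zero i 1
      ((algSystem hA hsl).piece_le_form γ h.isGenerator.1) ih

lemma IsRootVector.dot_self (hA : IsGCM A) (hsl : A.IsSimplyLaced) {γ : I → ℤ} {y : Alg A}
    (h : IsRootVector A γ y) : dot A γ γ = 2 := by
  induction h with
  | simple i => rw [dot_simpleRoot_simpleRoot, hA.diag]
  | neg _ ih => exact ih
  | reflect i _ ih => rw [dot_simpleReflection hA.diag (hA.symm_of_isSimplyLaced hsl), ih]

/-- Induction on the construction of `y`. For `e_i` the bracket is `refl i 1 z`. For a reflected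
vector, `z` is pulled back by `refl i (-1)`, and the resulting bracket is pushed forward again by
`refl i 1`. -/
lemma IsRootVector.isGenerator_lie {γ : I → ℤ} {y : Alg A} (h : IsRootVector A γ y) {δ : I → ℤ}
    {z : Alg A} (hz : (algSystem hA hsl).IsGenerator δ z) (hδ : dot A δ δ = 2)
    (hγδ : dot A γ δ = -1) : (algSystem hA hsl).IsGenerator (γ + δ) ⁅y, z⁆ := by
  have hs := hA.symm_of_isSimplyLaced hsl
  set S := algSystem hA hsl
  induction h generalizing δ z with
  | simple i =>
    have hδi : dot A δ (simpleRoot i) = -1 := by rw [KacMoody.dot_comm hs, hγδ]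
    have := hz.refl i (c := 1) rfl
    rw [ChevalleySystem.refl_eq_lie hz.1 hδ hδi] at this
    have e : simpleReflection A i δ = simpleRoot i + δ := by
      rw [simpleReflection, hδi]; module
    rwa [e] at this
  | neg _ ih =>
    rw [neg_lie]
    exact (ih hδ hγδ hz).neg
  | @reflect i γ y h ih =>
    have hy := S.piece_le_form γ (h.isGenerator (hA := hA) (hsl := hsl)).1
    have hz' := hz.refl i (c := -1) rfl
    have key := (ih (by rw [dot_simpleReflection hA.diag hs, hδ]) (by
      rw [← dot_simpleReflection hA.diag hs i, simpleReflection_simpleReflection hA.diag,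
        hγδ]) hz').refl i (c := 1) rfl
    rw [simpleReflection_add, simpleReflection_simpleReflection hA.diag,
      S.refl_lie i 1 hy (S.piece_le_form _ hz'.1), S.refl_refl_neg i 1 (S.piece_le_form _ hz.1),
      ← starReflection_eq] at key
    exact key

/-- The bracket of two root vectors whose roots have product `-1` is a root vector up to sign. -/
lemma IsRootVector.lie_eq (hA : IsGCM A) (hsl : A.IsSimplyLaced) {γ δ : I → ℤ} {y z w : Alg A}
    (hy : IsRootVector A γ y) (hz : IsRootVector A δ z) (hw : IsRootVector A (γ + δ) w)
    (h : dot A γ δ = -1) : ∃ ε : ℤ, (ε = 1 ∨ ε = -1) ∧ ⁅y, z⁆ = ε • w :=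
  (hw.isGenerator (hA := hA) (hsl := hsl)).eq_or_eq_neg
    (hy.isGenerator_lie hA hsl hz.isGenerator (hz.dot_self hA hsl) h) (hw.ne_zero hA hsl)

/-- Root vectors commute if the sum of their roots has norm greater than two. -/
lemma IsRootVector.lie_eq_zero (hA : IsGCM A) (hsl : A.IsSimplyLaced) {γ δ : I → ℤ} {y z : Alg A}
    (hy : IsRootVector A γ y) (hz : IsRootVector A δ z) (h : 2 < dot A (γ + δ) (γ + δ)) :
    ⁅y, z⁆ = 0 :=
  (algSystem hA hsl).eq_zero_of_two_lt_dot h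
    ((algSystem hA hsl).lie_mem hy.isGenerator.1 hz.isGenerator.1)

lemma IsRootVector.pos_or_neg (hA : IsGCM A) (hsl : A.IsSimplyLaced) {γ : I → ℤ} {y : Alg A}
    (hy : IsRootVector A γ y) : 0 < γ ∨ γ < 0 := by
  have hγ : γ ≠ 0 := by
    rintro rfl
    have := hy.dot_self hA hsl
    simp [dot] at this
  obtain ⟨s, hs⟩ := (algSystem hA hsl).pos_or_neg_of_mem_piece hy.isGenerator.1
    (hy.ne_zero hA hsl) hγ
  cases s
  · right; simpa [sgn] using hs
  · left; simpa [sgn] using hs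

/-- Root vectors stay nonzero in the enveloping algebra. -/
lemma IsRootVector.ι_ne_zero (hA : IsGCM A) (hsl : A.IsSimplyLaced) {γ : I → ℤ} {y : Alg A}
    (hy : IsRootVector A γ y) : UniversalEnvelopingAlgebra.ι ℂ y ≠ 0 := by
  intro h
  -- The adjoint representation factors through the enveloping algebra. If `y` were central, `[h_i,
  -- y] = 0` would make `γ` orthogonal to all simple roots, against `γ·γ = 2`.
  have had : LieAlgebra.ad ℂ (Alg A) y = 0 := by
    rw [← UniversalEnvelopingAlgebra.lift_ι_apply ℂ (LieAlgebra.ad ℂ (Alg A)) y, h, map_zero]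
  have hzero : ∀ i, dot A γ (simpleRoot i) = 0 := fun i => by
    have h₁ := (algSystem hA hsl).lie_h hy.isGenerator.1 i
    rw [← lie_skew, ← LieAlgebra.ad_apply ℂ, had, LinearMap.zero_apply, neg_zero] at h₁
    have h₂ : ((dot A γ (simpleRoot i) : ℤ) : ℂ) • y = 0 := by
      rw [Int.cast_smul_eq_zsmul, ← h₁]
    exact_mod_cast (smul_eq_zero.mp h₂).resolve_right (hy.ne_zero hA hsl)
  have := hy.dot_self hA hsl
  rw [dot_eq_sum_right] at this
  simp [hzero] at this

end Alg

/-! ## Real roots and prenilpotent pairs -/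

section Roots

variable {I : Type u} [Fintype I] [DecidableEq I] {A : Matrix I I ℤ}

/-- The simple reflection as an automorphism of the root lattice. -/
def simpleReflectionEquiv (hd : ∀ i, A i i = 2) (i : I) : (I → ℤ) ≃ₗ[ℤ] (I → ℤ) :=
  LinearEquiv.ofInvolutive
    { toFun := simpleReflection A i
      map_add' := simpleReflection_add i
      map_smul' := fun c x => simpleReflection_smul i c x }
    (simpleReflection_simpleReflection hd i)

@[simp] lemma simpleReflectionEquiv_apply (hd : ∀ i, A i i = 2) (i : I) (x : I → ℤ) :
    simpleReflectionEquiv hd i x = simpleReflection A i x := rfl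

lemma simpleReflectionEquiv_mem (hd : ∀ i, A i i = 2) (i : I) :
    simpleReflectionEquiv hd i ∈ weylGroup A := Subgroup.subset_closure ⟨i, fun _ => rfl⟩

lemma weylGroup_induction (hd : ∀ i, A i i = 2) {p : ((I → ℤ) ≃ₗ[ℤ] (I → ℤ)) → Prop} (h₁ : p 1)
    (hmul : ∀ i, ∀ w ∈ weylGroup A, p w → p (simpleReflectionEquiv hd i * w))
    {w : (I → ℤ) ≃ₗ[ℤ] (I → ℤ)} (hw : w ∈ weylGroup A) : p w := by
  have hgen : ∀ g : (I → ℤ) ≃ₗ[ℤ] (I → ℤ), (∃ i, ∀ x, g x = simpleReflection A i x) →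
      ∃ i, g = simpleReflectionEquiv hd i := fun g ⟨i, hi⟩ => ⟨i, LinearEquiv.ext hi⟩
  have hinv : ∀ i, (simpleReflectionEquiv hd i)⁻¹ = simpleReflectionEquiv hd i := fun i => by
    rw [inv_eq_iff_mul_eq_one]
    exact LinearEquiv.ext (simpleReflection_simpleReflection hd i)
  induction hw using Subgroup.closure_induction_left with
  | one => exact h₁
  | mul_left g hg w hw ih =>
    obtain ⟨i, rfl⟩ := hgen g hg
    exact hmul i w hw ih
  | inv_mul_cancel g hg w hw ih =>
    obtain ⟨i, rfl⟩ := hgen g hg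
    rw [hinv]
    exact hmul i w hw ih

lemma map_mem_realRoots {w : (I → ℤ) ≃ₗ[ℤ] (I → ℤ)} (hw : w ∈ weylGroup A) {γ : I → ℤ}
    (hγ : γ ∈ realRoots A) : w γ ∈ realRoots A := by
  obtain ⟨v, hv, i, rfl⟩ := hγ
  exact ⟨w * v, mul_mem hw hv, i, rfl⟩

lemma exists_isRootVector (hA : IsGCM A) {γ : I → ℤ} (hγ : γ ∈ realRoots A) :
    ∃ y, IsRootVector A γ y := by
  obtain ⟨w, hw, i, rfl⟩ := hγ
  refine weylGroup_induction hA.diag (p := fun w => ∃ y, IsRootVector A (w (simpleRoot i)) y)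
    ⟨_, .simple i⟩ ?_ hw
  rintro j w - ⟨y, hy⟩
  exact ⟨_, hy.reflect j⟩

variable (hA : IsGCM A) (hsl : A.IsSimplyLaced)
include hA hsl

lemma dot_map {w : (I → ℤ) ≃ₗ[ℤ] (I → ℤ)} (hw : w ∈ weylGroup A) (x y : I → ℤ) :
    dot A (w x) (w y) = dot A x y := by
  refine weylGroup_induction hA.diag (p := fun w => dot A (w x) (w y) = dot A x y) rfl ?_ hw
  intro i w _ ih
  rw [← ih]
  exact dot_simpleReflection hA.diag (hA.symm_of_isSimplyLaced hsl) i _ _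

lemma dot_self_of_mem_realRoots {γ : I → ℤ} (hγ : γ ∈ realRoots A) : dot A γ γ = 2 :=
  (exists_isRootVector hA hγ).elim fun _ h => h.dot_self hA hsl

lemma pos_or_neg_of_mem_realRoots {γ : I → ℤ} (hγ : γ ∈ realRoots A) : 0 < γ ∨ γ < 0 :=
  (exists_isRootVector hA hγ).elim fun _ h => h.pos_or_neg hA hsl

lemma exists_reflection {γ : I → ℤ} (hγ : γ ∈ realRoots A) :
    ∃ r ∈ weylGroup A, ∀ x, r x = x - dot A x γ • γ := by
  obtain ⟨w, hw, i, rfl⟩ := hγ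
  refine ⟨w * simpleReflectionEquiv hA.diag i * w⁻¹,
    mul_mem (mul_mem hw (simpleReflectionEquiv_mem hA.diag i)) (inv_mem hw), fun x => ?_⟩
  have hx : w (w⁻¹ x) = x := w.apply_symm_apply x
  have hdot : dot A x (w (simpleRoot i)) = dot A (w⁻¹ x) (simpleRoot i) := by
    conv_lhs => rw [← hx]
    exact dot_map hA hsl hw _ _
  change w (simpleReflection A i (w⁻¹ x)) = _
  rw [simpleReflection, map_sub, map_zsmul, hx, hdot]

lemma neg_mem_realRoots {γ : I → ℤ} (hγ : γ ∈ realRoots A) : -γ ∈ realRoots A := by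
  obtain ⟨r, hr, h⟩ := exists_reflection hA hsl hγ
  have := map_mem_realRoots hr hγ
  rw [h, dot_self_of_mem_realRoots hA hsl hγ] at this
  convert this using 1
  module

/-- Only the coordinate at `i` changes. If the image were negative, `γ` would be a nonnegative
multiple of `α_i` of norm 2, hence `α_i`. -/
lemma simpleReflection_pos {γ : I → ℤ} (hγ : γ ∈ realRoots A) (hpos : 0 < γ) {i : I}
    (hi : γ ≠ simpleRoot i) : 0 < simpleReflection A i γ := by
  refine (pos_or_neg_of_mem_realRoots hA hsl
    (map_mem_realRoots (simpleReflectionEquiv_mem hA.diag i) hγ)).resolve_right fun hneg => ?_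
  have hzero : ∀ j, j ≠ i → γ j = 0 := fun j hj => by
    have h₁ := hneg.le j
    rw [simpleReflectionEquiv_apply, simpleReflection_apply_of_ne i hj] at h₁
    exact le_antisymm h₁ (hpos.le j)
  have hm := eq_smul_simpleRoot hzero
  have hnorm := dot_self_of_mem_realRoots hA hsl hγ
  have h0 : 0 ≤ γ i := hpos.le i
  rw [hm, dot_smul_left, dot_smul_right, dot_simpleRoot_simpleRoot, hA.diag] at hnorm
  have h1 : γ i = 1 := by nlinarith
  rw [h1, one_smul] at hm
  exact hi hm

lemma mem_posRoots_iff {γ : I → ℤ} (hγ : γ ∈ realRoots A) : γ ∈ posRoots A ↔ 0 < γ :=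
  ⟨fun h => (pos_or_neg_of_mem_realRoots hA hsl hγ).resolve_right fun h' =>
    absurd (lt_of_le_of_lt (show (0 : I → ℤ) ≤ γ from h.2) h') (lt_irrefl _),
    fun h => ⟨hγ, h.le⟩⟩

lemma mem_negRoots_iff {γ : I → ℤ} (hγ : γ ∈ realRoots A) : γ ∈ negRoots A ↔ γ < 0 :=
  ⟨fun h => (pos_or_neg_of_mem_realRoots hA hsl hγ).resolve_left fun h' =>
    absurd (lt_of_lt_of_le h' (show γ ≤ (0 : I → ℤ) from h.2)) (lt_irrefl _),
    fun h => ⟨hγ, h.le⟩⟩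

/-- Multiplying by a simple reflection on the left adds at most one inversion, `w⁻¹α_i`, since `α_i`
is the only positive real root made negative by the reflection. -/
lemma finite_inversions {w : (I → ℤ) ≃ₗ[ℤ] (I → ℤ)} (hw : w ∈ weylGroup A) :
    {γ | γ ∈ realRoots A ∧ 0 < γ ∧ w γ < 0}.Finite := by
  refine weylGroup_induction hA.diag
    (p := fun w => {γ | γ ∈ realRoots A ∧ 0 < γ ∧ w γ < 0}.Finite) ?_ ?_ hw
  · convert Set.finite_empty
    ext γ
    simp only [Set.mem_ofPred_eq, Set.mem_empty_iff_false, iff_false]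
    rintro ⟨-, h, h'⟩
    exact lt_irrefl _ (h.trans h')
  · intro i w hw ih
    refine (ih.insert (w.symm (simpleRoot i))).subset ?_
    rintro γ ⟨hγ, hpos, hneg⟩
    have hwγ := map_mem_realRoots hw hγ
    rcases pos_or_neg_of_mem_realRoots hA hsl hwγ with h | h
    · left
      by_contra hne
      refine lt_irrefl _ ((simpleReflection_pos hA hsl hwγ h (i := i) fun h' => hne ?_).trans hneg)
      rw [← h', LinearEquiv.symm_apply_apply]
    · exact .inr ⟨hγ, hpos, h⟩

/-- The real roots that are nonnegative combinations of two positive real roots with product at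
most `-2` have no bound on their height. -/
lemma infinite_combinations {α β : I → ℤ} (hα : α ∈ realRoots A) (hβ : β ∈ realRoots A)
    (hα₀ : 0 < α) (hβ₀ : 0 < β) (h : dot A α β ≤ -2) :
    {γ | γ ∈ realRoots A ∧ ∃ m n : ℕ, γ = (m : ℤ) • α + (n : ℤ) • β}.Infinite := by
  intro hfin
  have hs := hA.symm_of_isSimplyLaced hsl
  -- If the set were finite, it would have an element `γ` of greatest height.
  obtain ⟨γ, ⟨hγ, m, n, hmn⟩, hmax⟩ := Set.exists_max_image _ (fun γ => ∑ i, γ i) hfin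
    ⟨α, hα, 1, 0, by simp⟩
  have hsum : ∀ δ : I → ℤ, 0 < δ → 0 < ∑ i, δ i := fun δ hδ => Fintype.sum_pos hδ
  have hα₂ := dot_self_of_mem_realRoots hA hsl hα
  have hβ₂ := dot_self_of_mem_realRoots hA hsl hβ
  have hγ₂ := dot_self_of_mem_realRoots hA hsl hγ
  have hγα : dot A γ α = 2 * m + n * dot A α β := by
    rw [hmn, dot_add_left, dot_smul_left, dot_smul_left, hα₂, dot_comm hs β α]; ring
  have hγβ : dot A γ β = 2 * n + m * dot A α β := by
    rw [hmn, dot_add_left, dot_smul_left, dot_smul_left, hβ₂]; ring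
  have hγγ : dot A γ γ = m * dot A γ α + n * dot A γ β := by
    conv_lhs => rw [hmn, dot_add_right, dot_smul_right, dot_smul_right, ← hmn]
  -- With `γ·δ < 0`, the reflection in `δ` would add a positive multiple of `δ` to `γ` and raise the
  -- height.
  have step : ∀ δ ∈ realRoots A, 0 < δ → (∀ c : ℕ, ∃ m' n' : ℕ,
      γ + (c : ℤ) • δ = (m' : ℤ) • α + (n' : ℤ) • β) → 0 ≤ dot A γ δ := by
    intro δ hδ hδ₀ hcomb
    by_contra! hneg
    obtain ⟨r, hr, hrx⟩ := exists_reflection hA hsl hδ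
    have hrγ := map_mem_realRoots hr hγ
    have hc : ((-dot A γ δ).toNat : ℤ) = -dot A γ δ := Int.toNat_of_nonneg (by omega)
    have e : r γ = γ + ((-dot A γ δ).toNat : ℤ) • δ := by
      rw [hrx, hc]; module
    obtain ⟨m', n', h'⟩ := hcomb (-dot A γ δ).toNat
    have hle := hmax (r γ) ⟨hrγ, m', n', by rw [e, h']⟩
    simp only [e, hc, Pi.add_apply, Pi.smul_apply, Finset.sum_add_distrib, smul_eq_mul,
      ← Finset.mul_sum] at hle
    have := mul_pos (neg_pos.mpr hneg) (hsum δ hδ₀)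
    linarith
  have h₁ := step α hα hα₀ fun c => ⟨m + c, n, by rw [hmn]; push_cast; module⟩
  have h₂ := step β hβ hβ₀ fun c => ⟨m, n + c, by rw [hmn]; push_cast; module⟩
  have hm : (0 : ℤ) ≤ m := Int.natCast_nonneg m
  have hn : (0 : ℤ) ≤ n := Int.natCast_nonneg n
  -- The sum equals `(m + n)(2 + α·β)`. Both products must then vanish, so `γ·γ = 0`, which is
  -- absurd.
  have h₃ : dot A γ α + dot A γ β ≤ 0 := by rw [hγα, hγβ]; nlinarith
  have h₄ : dot A γ α = 0 := by linarith
  have h₅ : dot A γ β = 0 := by linarith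
  rw [hγγ, h₄, h₅] at hγ₂
  simp at hγ₂

/-- The element `w' w⁻¹` would invert every real root that is a nonnegative combination of `wα` and
`wβ`. -/
lemma neg_one_le_dot_of_isPrenilpotent {α β : realRoots A} (h : IsPrenilpotent A α β) :
    -1 ≤ dot A α β := by
  by_contra! hlt
  obtain ⟨⟨w, hw, hwα, hwβ⟩, w', hw', hwα', hwβ'⟩ := h
  have hα := hwα.1
  have hβ := hwβ.1
  have hα₀ := (mem_posRoots_iff hA hsl hα).mp hwα
  have hβ₀ := (mem_posRoots_iff hA hsl hβ).mp hwβ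
  have hg : w' * w⁻¹ ∈ weylGroup A := mul_mem hw' (inv_mem hw)
  have hgw : ∀ x, (w' * w⁻¹) (w x) = w' x := fun x => congrArg w' (w.symm_apply_apply x)
  refine infinite_combinations hA hsl hα hβ hα₀ hβ₀
    (by rw [dot_map hA hsl hw]; omega) ((finite_inversions hA hsl hg).subset ?_)
  rintro γ ⟨hγ, m, n, hmn⟩
  have hgγ := map_mem_realRoots hg hγ
  refine ⟨hγ, (mem_posRoots_iff hA hsl hγ).mp ⟨hγ, ?_⟩, (mem_negRoots_iff hA hsl hgγ).mp ⟨hgγ, ?_⟩⟩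
  · change 0 ≤ γ
    rw [hmn]
    exact add_nonneg (smul_nonneg (Int.natCast_nonneg m) hα₀.le)
      (smul_nonneg (Int.natCast_nonneg n) hβ₀.le)
  · change (w' * w⁻¹) γ ≤ 0
    rw [hmn, map_add, map_zsmul, map_zsmul, hgw, hgw]
    exact add_nonpos (smul_nonpos_of_nonneg_of_nonpos (Int.natCast_nonneg m) hwα'.2)
      (smul_nonpos_of_nonneg_of_nonpos (Int.natCast_nonneg n) hwβ'.2)

/-- After moving `α` to a simple root `α_i`, only `β < 0` needs work. If `α_i·β ≥ 0`, the reflection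
in `β` adds a nonnegative multiple of `-β` to `α_i` and sends `β` to `-β`. -/
lemma exists_map_pos {α β : I → ℤ} (hα : α ∈ realRoots A) (hβ : β ∈ realRoots A) (hne : α ≠ β)
    (h : -1 ≤ dot A α β) : ∃ w ∈ weylGroup A, 0 < w α ∧ 0 < w β := by
  have hs := hA.symm_of_isSimplyLaced hsl
  suffices H : ∀ i, ∀ β ∈ realRoots A, simpleRoot i ≠ β → -1 ≤ dot A (simpleRoot i) β →
      ∃ w ∈ weylGroup A, 0 < w (simpleRoot i) ∧ 0 < w β by
    obtain ⟨v, hv, i, rfl⟩ := hα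
    obtain ⟨w, hw, h₁, h₂⟩ := H i (v⁻¹ β) (map_mem_realRoots (inv_mem hv) hβ)
      (fun h' => hne (by rw [h']; exact v.apply_symm_apply β)) (by
        rw [← dot_map hA hsl hv]
        exact h.trans_eq (congrArg _ (v.apply_symm_apply β).symm))
    refine ⟨w * v⁻¹, mul_mem hw (inv_mem hv), ?_, h₂⟩
    exact h₁.trans_eq (congrArg w (v.symm_apply_apply _).symm)
  clear! α β
  intro i β hβ hne h
  rcases pos_or_neg_of_mem_realRoots hA hsl hβ with hpos | hneg
  · exact ⟨1, one_mem _, simpleRoot_pos i, hpos⟩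
  have hγ := neg_mem_realRoots hA hsl hβ
  have hγ₀ : 0 < -β := neg_pos.mpr hneg
  have hβ₂ := dot_self_of_mem_realRoots hA hsl hβ
  obtain ⟨r, hr, hrx⟩ := exists_reflection hA hsl hβ
  by_cases h1 : dot A (simpleRoot i) β = -1
  · have hpos : 0 < simpleReflection A i (-β) := by
      refine simpleReflection_pos hA hsl hγ hγ₀ fun h' => ?_
      rw [← h', dot_neg_left, hβ₂] at h1
      omega
    have h1' : dot A β (simpleRoot i) = -1 := by rw [dot_comm hs, h1]
    have hr₁ : r (-simpleRoot i) = -simpleRoot i - β := by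
      rw [hrx, dot_neg_left, h1]; module
    have hr₂ : r (simpleRoot i + β) = simpleRoot i := by
      rw [hrx, dot_add_left, h1, hβ₂]; module
    -- The product sends `β` to `α_i` and `α_i` to `-α_i - β = s_i(-β)`, which is positive because
    -- `-β ≠ α_i`.
    refine ⟨r * simpleReflectionEquiv hA.diag i,
      mul_mem hr (simpleReflectionEquiv_mem hA.diag i), ?_, ?_⟩
    · change 0 < r (simpleReflection A i (simpleRoot i))
      rw [simpleReflection_simpleRoot hA.diag, hr₁]
      rw [simpleReflection, dot_neg_left, h1'] at hpos
      convert hpos using 1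
      module
    · change 0 < r (simpleReflection A i β)
      have e : simpleReflection A i β = simpleRoot i + β := by
        rw [simpleReflection, h1']; module
      rw [e, hr₂]
      exact simpleRoot_pos i
  · refine ⟨r, hr, ?_, ?_⟩
    · rw [hrx, sub_eq_add_neg, ← smul_neg]
      exact add_pos_of_pos_of_nonneg (simpleRoot_pos i) (smul_nonneg (by omega) hγ₀.le)
    · rw [hrx, hβ₂]
      convert hγ₀ using 1
      module

lemma isPrenilpotent_iff {α β : realRoots A} (hne : α ≠ β) :
    IsPrenilpotent A α β ↔ -1 ≤ dot A α β := by
  refine ⟨neg_one_le_dot_of_isPrenilpotent hA hsl, fun h => ⟨?_, ?_⟩⟩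
  · obtain ⟨w, hw, h₁, h₂⟩ := exists_map_pos hA hsl α.2 β.2 (fun h' => hne (Subtype.ext h')) h
    exact ⟨w, hw, ⟨map_mem_realRoots hw α.2, h₁.le⟩, ⟨map_mem_realRoots hw β.2, h₂.le⟩⟩
  -- Making `α` and `β` negative is making `-α` and `-β` positive, and these have the same product.
  · obtain ⟨w, hw, h₁, h₂⟩ := exists_map_pos hA hsl (neg_mem_realRoots hA hsl α.2)
      (neg_mem_realRoots hA hsl β.2) (fun h' => hne (Subtype.ext (neg_injective h')))
      (by rwa [dot_neg_left, dot_neg_right, neg_neg])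
    rw [map_neg, neg_pos] at h₁ h₂
    exact ⟨w, hw, ⟨map_mem_realRoots hw α.2, h₁.le⟩, ⟨map_mem_realRoots hw β.2, h₂.le⟩⟩

end Roots

/-! ## Exponential series in two commuting variables -/

section Series

variable {E : Type*} [Ring E] [Algebra ℂ E]

/-- The divided power `z ^ k / k!`. -/
def divPow (z : E) (k : ℕ) : E := (k.factorial : ℂ)⁻¹ • z ^ k

@[simp] lemma divPow_zero (z : E) : divPow z 0 = 1 := by simp [divPow]

lemma mul_divPow (z : E) (k : ℕ) : z * divPow z k = ((k : ℂ) + 1) • divPow z (k + 1) := by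
  have : (k : ℂ) + 1 ≠ 0 := by exact_mod_cast Nat.succ_ne_zero k
  rw [divPow, divPow, mul_smul_comm, ← pow_succ', smul_smul, Nat.factorial_succ]
  congr 1
  push_cast
  field_simp

lemma divPow_mul (z : E) (k : ℕ) : divPow z k * z = ((k : ℂ) + 1) • divPow z (k + 1) := by
  rw [← mul_divPow, divPow, smul_mul_assoc, mul_smul_comm, pow_mul_comm']

lemma Commute.divPow_right {x z : E} (h : Commute x z) (k : ℕ) : Commute x (divPow z k) :=
  (h.pow_right k).smul_right _

lemma mul_divPow_of_commutator {a b c : E} (hab : a * b = b * a + c) (hcb : Commute c b) (k : ℕ) :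
    a * divPow b (k + 1) = divPow b (k + 1) * a + c * divPow b k := by
  have h : a * b ^ (k + 1) = b ^ (k + 1) * a + ((k : ℂ) + 1) • (c * b ^ k) := by
    induction k with
    | zero => simp [hab]
    | succ k ih =>
      rw [pow_succ, ← mul_assoc, ih, add_mul, mul_assoc, hab, mul_add, smul_mul_assoc,
        mul_assoc c, ← pow_succ, ← (hcb.pow_right (k + 1)).eq, ← mul_assoc, ← pow_succ, add_assoc]
      congr 1
      push_cast
      module
  have hk : (k : ℂ) + 1 ≠ 0 := by exact_mod_cast Nat.succ_ne_zero k
  rw [divPow, divPow, mul_smul_comm, h, smul_add, smul_mul_assoc, mul_smul_comm, smul_smul,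
    Nat.factorial_succ]
  congr 2
  push_cast
  field_simp

/-- A summand in the reordering of `divPow a p * divPow b q`. -/
def reorderTerm (a b c : E) (p q k : ℕ) : E :=
  if k ≤ p ∧ k ≤ q then divPow c k * (divPow b (q - k) * divPow a (p - k)) else 0

/-- `a` passes the powers of `c` and, in crossing the power of `b`, either survives or leaves one
more `c`. The coefficients arise from absorbing the new factor into a divided power. -/
lemma mul_reorderTerm {a b c : E} (hab : a * b = b * a + c) (hca : Commute c a)
    (hcb : Commute c b) (p q k : ℕ) :
    a * reorderTerm a b c p q k = ((p : ℂ) + 1 - k) • reorderTerm a b c (p + 1) q k +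
      ((k : ℂ) + 1) • reorderTerm a b c (p + 1) q (k + 1) := by
  by_cases hkq : k ≤ q
  swap
  · simp [reorderTerm, hkq, show ¬ k + 1 ≤ q by omega]
  by_cases hkp : k ≤ p
  swap
  · rcases Nat.lt_or_ge (p + 1) k with h | h
    · simp [reorderTerm, hkp, show ¬ k ≤ p + 1 by omega]
    · obtain rfl : k = p + 1 := by omega
      simp [reorderTerm]
  obtain ⟨r, rfl⟩ := Nat.exists_eq_add_of_le hkq
  obtain ⟨s, rfl⟩ := Nat.exists_eq_add_of_le hkp
  have hac : a * divPow c k = divPow c k * a := (Commute.divPow_right hca.symm k).eq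
  have hT : reorderTerm a b c (k + s) (k + r) k = divPow c k * (divPow b r * divPow a s) := by
    simp [reorderTerm]
  have hT' : reorderTerm a b c (k + s + 1) (k + r) k =
      divPow c k * (divPow b r * divPow a (s + 1)) := by
    rw [reorderTerm, if_pos (by omega), show k + s + 1 - k = s + 1 by omega,
      show k + r - k = r by omega]
  rw [hT, hT', ← mul_assoc, hac, mul_assoc, ← mul_assoc a]
  have hs : (((k + s : ℕ) : ℂ) + 1 - k) = (s : ℂ) + 1 := by push_cast; ring
  rw [hs]
  cases r with
  | zero =>
    rw [reorderTerm, if_neg (by omega), divPow_zero, mul_one, one_mul, mul_divPow,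
      mul_smul_comm, smul_zero, add_zero]
  | succ r =>
    rw [mul_divPow_of_commutator hab hcb, add_mul, mul_assoc, mul_divPow, mul_add, mul_smul_comm,
      mul_smul_comm, mul_assoc c, ← mul_assoc _ c, divPow_mul, smul_mul_assoc, reorderTerm,
      if_pos (by omega), show k + (r + 1) - (k + 1) = r by omega,
      show k + s + 1 - (k + 1) = s by omega]

/-- Induction on `p` after multiplying by `p + 1`. Shifting the index in the terms with an extra `c`
gives the coefficients `(p + 1 - k) + k = p + 1`. Terms with `k > p` vanish, so any bound `M > p`
serves. -/
lemma divPow_mul_divPow {a b c : E} (hab : a * b = b * a + c) (hca : Commute c a)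
    (hcb : Commute c b) (p q M : ℕ) (hM : p < M) :
    divPow a p * divPow b q = ∑ k ∈ Finset.range M, reorderTerm a b c p q k := by
  induction p generalizing M with
  | zero =>
    rw [Finset.sum_eq_single_of_mem 0 (by simpa using hM)
      (fun k _ hk => by simp [reorderTerm, hk])]
    simp [reorderTerm]
  | succ p ih =>
    obtain ⟨M, rfl⟩ : ∃ M', M = M' + 1 := ⟨M - 1, by omega⟩
    have hp : (p : ℂ) + 1 ≠ 0 := by exact_mod_cast Nat.succ_ne_zero p
    apply smul_right_injective E hp
    simp only
    rw [← smul_mul_assoc, ← mul_divPow, mul_assoc, ih (M + 1) (by omega), Finset.mul_sum,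
      Finset.smul_sum]
    simp only [mul_reorderTerm hab hca hcb, Finset.sum_add_distrib]
    have hshift : ∑ k ∈ Finset.range (M + 1),
        ((k : ℂ) + 1) • reorderTerm a b c (p + 1) q (k + 1) =
          ∑ k ∈ Finset.range (M + 1), (k : ℂ) • reorderTerm a b c (p + 1) q k := by
      have h₁ := Finset.sum_range_succ' (fun k => (k : ℂ) • reorderTerm a b c (p + 1) q k) (M + 1)
      rw [Finset.sum_range_succ] at h₁
      have h₂ : reorderTerm a b c (p + 1) q (M + 1) = 0 := by
        rw [reorderTerm, if_neg (by omega)]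
      simp only [h₂, smul_zero, add_zero, Nat.cast_zero, zero_smul] at h₁
      rw [h₁]
      refine Finset.sum_congr rfl fun k _ => ?_
      push_cast
      rfl
    rw [hshift, ← Finset.sum_add_distrib]
    refine Finset.sum_congr rfl fun k _ => ?_
    rw [← add_smul]
    congr 1
    ring

lemma sum_divPow_mul_divPow_neg (z : E) (N : ℕ) :
    ∑ k ∈ Finset.range (N + 1), divPow z k * divPow (-z) (N - k) = if N = 0 then 1 else 0 := by
  have h := (Commute.neg_right (Commute.refl z)).add_pow N
  rw [add_neg_cancel] at h
  have h' : ∑ k ∈ Finset.range (N + 1), divPow z k * divPow (-z) (N - k) =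
      (N.factorial : ℂ)⁻¹ • ∑ k ∈ Finset.range (N + 1), z ^ k * (-z) ^ (N - k) * (N.choose k : E) := by
    rw [Finset.smul_sum]
    refine Finset.sum_congr rfl fun k hk => ?_
    have hk : k ≤ N := by simpa [Nat.lt_succ_iff] using hk
    rw [divPow, divPow, smul_mul_assoc, mul_smul_comm, smul_smul, ← nsmul_eq_mul',
      ← Nat.cast_smul_eq_nsmul ℂ, smul_smul]
    congr 1
    rw [Nat.cast_choose ℂ hk]
    have := Nat.factorial_ne_zero N
    field_simp
  rw [h', ← h]
  split_ifs with h0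
  · subst h0; simp
  · simp [h0]

/-- The series `exp(z T)` for the monomial `T` with exponent `e`. -/
def expMonomial (e : Fin 2 →₀ ℕ) (z : E) : MvPowerSeries (Fin 2) E := fun d =>
  ∑ k ∈ Finset.range (d 0 + d 1 + 1), if d = k • e then divPow z k else 0

lemma coeff_expMonomial (e : Fin 2 →₀ ℕ) (z : E) (d : Fin 2 →₀ ℕ) :
    MvPowerSeries.coeff d (expMonomial e z) =
      ∑ k ∈ Finset.range (d 0 + d 1 + 1), if d = k • e then divPow z k else 0 := rfl

lemma le_of_smul_le {e d : Fin 2 →₀ ℕ} (he : e ≠ 0) {k : ℕ} (h : k • e ≤ d) : k ≤ d 0 + d 1 := by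
  have h0 := h 0
  have h1 := h 1
  simp only [Finsupp.smul_apply, smul_eq_mul] at h0 h1
  have : e 0 ≠ 0 ∨ e 1 ≠ 0 := by
    by_contra! hcon
    exact he (Finsupp.ext fun i => by fin_cases i; exacts [hcon.1, hcon.2])
  rcases this with h | h
  · nlinarith [Nat.le_mul_of_pos_right k (Nat.pos_of_ne_zero h)]
  · nlinarith [Nat.le_mul_of_pos_right k (Nat.pos_of_ne_zero h)]

lemma smul_injective_of_ne_zero {e : Fin 2 →₀ ℕ} (he : e ≠ 0) {k l : ℕ} (h : k • e = l • e) :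
    k = l := by
  obtain ⟨i, hi⟩ := Finsupp.ne_iff.mp he
  have := DFunLike.congr_fun h i
  simp only [Finsupp.smul_apply, smul_eq_mul] at this
  exact Nat.eq_of_mul_eq_mul_right (Nat.pos_of_ne_zero hi) this

lemma coeff_smul_expMonomial {e : Fin 2 →₀ ℕ} (he : e ≠ 0) (z : E) (N : ℕ) :
    MvPowerSeries.coeff (N • e) (expMonomial e z) = divPow z N := by
  rw [coeff_expMonomial, Finset.sum_eq_single_of_mem N, if_pos rfl]
  · rw [Finset.mem_range, Nat.lt_succ_iff]
    exact le_of_smul_le he le_rfl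
  · intro k _ hk
    exact if_neg fun h => hk (smul_injective_of_ne_zero he h.symm)

lemma coeff_expMonomial_eq_zero {e d : Fin 2 →₀ ℕ} (z : E) (h : ∀ N : ℕ, d ≠ N • e) :
    MvPowerSeries.coeff d (expMonomial e z) = 0 := by
  rw [coeff_expMonomial]
  exact Finset.sum_eq_zero fun k _ => if_neg (h k)

/-- Only the exponents `k • e ≤ d` contribute. As `e ≠ 0`, these have `k ≤ d 0 + d 1`, so the
truncation loses nothing. -/
lemma coeff_expMonomial_mul {e : Fin 2 →₀ ℕ} (he : e ≠ 0) (z : E) (ψ : MvPowerSeries (Fin 2) E)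
    (d : Fin 2 →₀ ℕ) : MvPowerSeries.coeff d (expMonomial e z * ψ) =
      ∑ k ∈ Finset.range (d 0 + d 1 + 1),
        if k • e ≤ d then divPow z k * MvPowerSeries.coeff (d - k • e) ψ else 0 := by
  rw [MvPowerSeries.coeff_mul]
  have h : ∀ p ∈ Finset.HasAntidiagonal.antidiagonal d,
      MvPowerSeries.coeff p.1 (expMonomial e z) * MvPowerSeries.coeff p.2 ψ =
      ∑ k ∈ Finset.range (d 0 + d 1 + 1),
        if p.1 = k • e then divPow z k * MvPowerSeries.coeff p.2 ψ else 0 := by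
    intro p hp
    rw [Finset.HasAntidiagonal.mem_antidiagonal] at hp
    rw [coeff_expMonomial, Finset.sum_mul]
    simp only [ite_mul, zero_mul]
    refine Finset.sum_subset ?_ ?_
    · subst hp
      intro k
      simp only [Finset.mem_range, Finsupp.add_apply]
      omega
    · intro k _ hk
      refine if_neg fun h' => hk ?_
      rw [Finset.mem_range, Nat.lt_succ_iff]
      exact le_of_smul_le he h'.ge
  rw [Finset.sum_congr rfl h, Finset.sum_comm]
  refine Finset.sum_congr rfl fun k _ => ?_
  split_ifs with hk
  · rw [Finset.sum_eq_single_of_mem (k • e, d - k • e), if_pos rfl]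
    · rw [Finset.HasAntidiagonal.mem_antidiagonal]
      exact add_tsub_cancel_of_le hk
    · intro p hp hne
      rw [Finset.HasAntidiagonal.mem_antidiagonal] at hp
      refine if_neg fun h' => hne (Prod.ext h' ?_)
      rw [← hp, h', add_tsub_cancel_left]
  · refine Finset.sum_eq_zero fun p hp => if_neg fun h' => hk ?_
    rw [Finset.HasAntidiagonal.mem_antidiagonal] at hp
    rw [← h', ← hp]
    exact le_self_add

lemma expMonomial_mul_neg {e : Fin 2 →₀ ℕ} (he : e ≠ 0) (z : E) :
    expMonomial e z * expMonomial e (-z) = 1 := by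
  ext d
  rw [coeff_expMonomial_mul he, MvPowerSeries.coeff_one]
  by_cases hd : ∃ N : ℕ, d = N • e
  · obtain ⟨N, rfl⟩ := hd
    have hiff : ∀ k : ℕ, k • e ≤ N • e ↔ k ≤ N := fun k => by
      refine ⟨fun h => ?_, fun h => nsmul_le_nsmul_left zero_le h⟩
      obtain ⟨i, hi⟩ := Finsupp.ne_iff.mp he
      have := h i
      simp only [Finsupp.smul_apply, smul_eq_mul] at this
      exact Nat.le_of_mul_le_mul_right this (Nat.pos_of_ne_zero hi)
    have hterm : ∀ k : ℕ, (if k • e ≤ N • e then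
        divPow z k * MvPowerSeries.coeff (N • e - k • e) (expMonomial e (-z)) else 0) =
        if k ≤ N then divPow z k * divPow (-z) (N - k) else 0 := fun k => by
      simp only [hiff]
      refine if_congr Iff.rfl ?_ rfl
      have hsub : N • e - k • e = (N - k) • e := by
        ext i; simp [Nat.sub_mul]
      rw [hsub, coeff_smul_expMonomial he]
    simp only [hterm]
    have hN : N + 1 ≤ (N • e) 0 + (N • e) 1 + 1 := Nat.succ_le_succ (le_of_smul_le he le_rfl)
    rw [← Finset.sum_subset (Finset.range_subset_range.mpr hN)]
    · rw [Finset.sum_congr rfl fun k hk => if_pos (Nat.lt_succ_iff.mp (Finset.mem_range.mp hk)),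
        sum_divPow_mul_divPow_neg]
      refine if_congr ⟨fun h => by rw [h, zero_smul], fun h => ?_⟩ rfl rfl
      exact smul_injective_of_ne_zero he (by rw [h, zero_smul])
    · intro k _ hk
      exact if_neg fun h => hk (Finset.mem_range.mpr (Nat.lt_succ_iff.mpr h))
  · push Not at hd
    rw [if_neg (fun h => hd 0 (by rw [h, zero_smul]))]
    refine Finset.sum_eq_zero fun k _ => ?_
    split_ifs with hk
    · rw [coeff_expMonomial_eq_zero, mul_zero]
      intro N hN
      refine hd (N + k) ?_
      rw [add_smul, ← hN, tsub_add_cancel_of_le hk]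
    · rfl

/-- The exponent of the variable number `i`. -/
abbrev expo (i : Fin 2) : Fin 2 →₀ ℕ := Finsupp.single i 1

lemma expo_ne_zero (i : Fin 2) : expo i ≠ 0 := by simp

lemma coeff_expMonomial_mul_expMonomial {i j : Fin 2} (hij : i ≠ j) (y z : E) (d : Fin 2 →₀ ℕ) :
    MvPowerSeries.coeff d (expMonomial (expo i) y * expMonomial (expo j) z) =
      divPow y (d i) * divPow z (d j) := by
  have hd : ∀ l, l = i ∨ l = j := fun l => by omega
  rw [coeff_expMonomial_mul (expo_ne_zero i), Finset.sum_eq_single_of_mem (d i)]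
  · have hle : d i • expo i ≤ d := by simp
    have hsub : d - d i • expo i = d j • expo j := by
      ext l
      rcases hd l with rfl | rfl
      · simp [hij]
      · simp [hij]
    rw [if_pos hle, hsub, coeff_smul_expMonomial (expo_ne_zero j)]
  · rw [Finset.mem_range]
    fin_cases i <;> simp
  · intro k _ hk
    split_ifs with hle
    · rw [coeff_expMonomial_eq_zero, mul_zero]
      intro N hN
      have h₁ := hle i
      have h₂ := DFunLike.congr_fun hN i
      simp [hij] at h₁ h₂
      omega
    · rfl

lemma expMonomial_commutator {a b c : E} (hab : a * b = b * a + c) (hca : Commute c a)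
    (hcb : Commute c b) :
    expMonomial (expo 0) a * expMonomial (expo 1) b * expMonomial (expo 0) (-a) *
      expMonomial (expo 1) (-b) = expMonomial (expo 0 + expo 1) c := by
  have he : expo 0 + expo 1 ≠ 0 := fun h => by
    have := DFunLike.congr_fun h 0
    simp at this
  -- Coefficientwise this is the reordering of `a^p b^q / (p! q!)`. The two inverse exponentials
  -- then cancel from the inside.
  have key : expMonomial (expo 0) a * expMonomial (expo 1) b =
      expMonomial (expo 0 + expo 1) c * (expMonomial (expo 1) b * expMonomial (expo 0) a) := by
    ext d
    rw [coeff_expMonomial_mul_expMonomial (by decide), coeff_expMonomial_mul he,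
      divPow_mul_divPow hab hca hcb _ _ (d 0 + d 1 + 1) (by omega)]
    refine Finset.sum_congr rfl fun k _ => ?_
    rw [reorderTerm]
    refine if_congr ?_ ?_ rfl
    · refine ⟨fun h l => ?_, fun h => ?_⟩
      · fin_cases l
        · simpa using h.1
        · simpa using h.2
      · have h0 := h 0
        have h1 := h 1
        simp at h0 h1
        exact ⟨h0, h1⟩
    · rw [coeff_expMonomial_mul_expMonomial (by decide)]
      simp
  rw [key, mul_assoc (_ * _), mul_assoc, mul_assoc, ← mul_assoc (expMonomial (expo 0) a),
    expMonomial_mul_neg (expo_ne_zero 0), one_mul, expMonomial_mul_neg (expo_ne_zero 1), mul_one]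

lemma expMonomial_zero {e : Fin 2 →₀ ℕ} (he : e ≠ 0) : expMonomial e (0 : E) = 1 := by
  have hz : ∀ N : ℕ, divPow (0 : E) N = if N = 0 then 1 else 0 := fun N => by
    rcases N.eq_zero_or_pos with rfl | h
    · simp
    · simp [divPow, h.ne']
  ext d
  rw [MvPowerSeries.coeff_one]
  by_cases hd : ∃ N : ℕ, d = N • e
  · obtain ⟨N, rfl⟩ := hd
    rw [coeff_smul_expMonomial he, hz]
    refine if_congr ⟨fun h => by rw [h, zero_smul], fun h => ?_⟩ rfl rfl
    exact smul_injective_of_ne_zero he (by rw [h, zero_smul])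
  · push Not at hd
    rw [coeff_expMonomial_eq_zero _ hd, if_neg (fun h => hd 0 (by rw [h, zero_smul]))]

end Series

/-! ### The series of the statement as exponentials of monomials -/

section ExpSeries

variable {I : Type u} [DecidableEq I] [Fintype I] (A : Matrix I I ℤ)

lemma expSeries_eq (m n : ℕ) (c : ℤ) (x : Alg A) {e : Fin 2 →₀ ℕ} (h₀ : e 0 = m) (h₁ : e 1 = n) :
    expSeries A m n c x = expMonomial e (c • UniversalEnvelopingAlgebra.ι ℂ x) := by
  funext d
  refine Finset.sum_congr rfl fun k _ => ?_
  refine if_congr ⟨fun h => Finsupp.ext fun i => ?_, fun h => ?_⟩ ?_ rfl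
  · fin_cases i
    · simpa [h₀] using h.1
    · simpa [h₁] using h.2
  · rw [h]
    simp [h₀, h₁]
  · rw [divPow, ← Int.cast_smul_eq_zsmul ℂ, smul_pow, smul_smul, mul_comm]

end ExpSeries

/-! ## Chevalley relations -/

section Chevalley

variable {I : Type u} [Fintype I] [DecidableEq I] {A : Matrix I I ℤ}

lemma expSeries_commutator {x y z : Alg A} {ε : ℤ} (h : ⁅x, y⁆ = ε • z) (hx : ⁅z, x⁆ = 0)
    (hy : ⁅z, y⁆ = 0) :
    expSeries A 1 0 1 x * expSeries A 0 1 1 y * expSeries A 1 0 (-1) x * expSeries A 0 1 (-1) y =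
      expSeries A 1 1 ε z := by
  have hι : ∀ x y : Alg A, UniversalEnvelopingAlgebra.ι ℂ x * UniversalEnvelopingAlgebra.ι ℂ y =
      UniversalEnvelopingAlgebra.ι ℂ y * UniversalEnvelopingAlgebra.ι ℂ x +
        UniversalEnvelopingAlgebra.ι ℂ ⁅x, y⁆ := fun x y => by
    rw [LieHom.map_lie, Ring.lie_def]; abel
  have hcomm : ∀ w, ⁅z, w⁆ = 0 → Commute (ε • UniversalEnvelopingAlgebra.ι ℂ z)
      (UniversalEnvelopingAlgebra.ι ℂ w) := fun w hw => by
    refine Commute.smul_left ?_ ε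
    have := hι z w
    rwa [hw, map_zero, add_zero] at this
  have hxy := hι x y
  rw [h, map_zsmul] at hxy
  have key := expMonomial_commutator hxy (hcomm x hx) (hcomm y hy)
  rw [expSeries_eq A 1 0 1 x (e := expo 0) (by simp) (by simp),
    expSeries_eq A 0 1 1 y (e := expo 1) (by simp) (by simp),
    expSeries_eq A 1 0 (-1) x (e := expo 0) (by simp) (by simp),
    expSeries_eq A 0 1 (-1) y (e := expo 1) (by simp) (by simp),
    expSeries_eq A 1 1 ε z (e := expo 0 + expo 1) (by simp) (by simp)]
  simpa only [one_smul, neg_smul] using key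

lemma expSeries_commutator_of_lie_eq_zero {x y : Alg A} (h : ⁅x, y⁆ = 0) :
    expSeries A 1 0 1 x * expSeries A 0 1 1 y * expSeries A 1 0 (-1) x * expSeries A 0 1 (-1) y =
      1 := by
  rw [expSeries_commutator (z := 0) (ε := 0) (by simpa using h) (zero_lie _) (zero_lie _),
    expSeries_eq A 1 1 0 0 (e := expo 0 + expo 1) (by simp) (by simp), zero_smul]
  refine expMonomial_zero fun h => ?_
  have := DFunLike.congr_fun h 0
  simp at this

/-- The coefficient of `tu` is `c` times the image of `z`. This is what makes the integer in a
Chevalley relation unique. -/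
lemma expSeries_one_one_injective {z : Alg A} (hz : UniversalEnvelopingAlgebra.ι ℂ z ≠ 0)
    {c d : ℤ} (h : expSeries A 1 1 c z = expSeries A 1 1 d z) : c = d := by
  have he : expo 0 + expo 1 ≠ 0 := fun h => by
    have := DFunLike.congr_fun h 0
    simp at this
  have h' := congrArg (MvPowerSeries.coeff ((1 : ℕ) • (expo 0 + expo 1))) h
  rw [expSeries_eq A 1 1 c z (e := expo 0 + expo 1) (by simp) (by simp),
    expSeries_eq A 1 1 d z (e := expo 0 + expo 1) (by simp) (by simp),
    coeff_smul_expMonomial he, coeff_smul_expMonomial he] at h'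
  simp only [divPow, Nat.factorial_one, Nat.cast_one, inv_one, one_smul, pow_one] at h'
  rw [← Int.cast_smul_eq_zsmul ℂ, ← Int.cast_smul_eq_zsmul ℂ] at h'
  exact_mod_cast smul_left_injective ℂ hz h'

variable (hA : IsGCM A) (hsl : A.IsSimplyLaced)
include hA hsl

lemma norm_combination {α β : I → ℤ} (hα : α ∈ realRoots A) (hβ : β ∈ realRoots A) (m n : ℕ)
    (h : m • α + n • β ∈ realRoots A) :
    (m : ℤ) * m + n * n + m * n * dot A α β = 1 := by
  have := dot_self_of_mem_realRoots hA hsl h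
  rw [← natCast_zsmul, ← natCast_zsmul] at this
  simp only [dot_add_left, dot_add_right, dot_smul_left, dot_smul_right,
    dot_self_of_mem_realRoots hA hsl hα, dot_self_of_mem_realRoots hA hsl hβ,
    dot_comm (hA.symm_of_isSimplyLaced hsl) β α] at this
  linarith

/-- There are no further real roots among the combinations of two roots with nonnegative
product. -/
lemma combination_of_dot_nonneg {α β : I → ℤ} (hα : α ∈ realRoots A) (hβ : β ∈ realRoots A)
    (hd : 0 ≤ dot A α β) (m n : ℕ) (h : m • α + n • β ∈ realRoots A) :
    (m = 1 ∧ n = 0) ∨ (m = 0 ∧ n = 1) := by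
  have h1 := norm_combination hA hsl hα hβ m n h
  have h2 : (0 : ℤ) ≤ m * n * dot A α β := by positivity
  have hm : m ≤ 1 := by zify; nlinarith
  have hn : n ≤ 1 := by zify; nlinarith
  interval_cases m <;> interval_cases n <;> simp at h1 h2 ⊢
  omega

lemma combination_of_dot_eq_neg_one {α β : I → ℤ} (hα : α ∈ realRoots A) (hβ : β ∈ realRoots A)
    (hd : dot A α β = -1) (m n : ℕ) (h : m • α + n • β ∈ realRoots A) :
    (m = 1 ∧ n = 0) ∨ (m = 0 ∧ n = 1) ∨ (m = 1 ∧ n = 1) := by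
  have h1 := norm_combination hA hsl hα hβ m n h
  rw [hd] at h1
  -- Here `m² + n² - mn = 1`, that is, `(m - 2n)² + 3m² = 4`.
  have hm : m ≤ 1 := by zify; nlinarith [sq_nonneg ((m : ℤ) - 2 * n)]
  have hn : n ≤ 1 := by zify; nlinarith [sq_nonneg ((n : ℤ) - 2 * m)]
  interval_cases m <;> interval_cases n <;> simp at h1 ⊢

lemma add_mem_realRoots {α β : I → ℤ} (hα : α ∈ realRoots A) (hβ : β ∈ realRoots A)
    (hd : dot A α β = -1) : α + β ∈ realRoots A := by
  obtain ⟨r, hr, h⟩ := exists_reflection hA hsl hβ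
  have := map_mem_realRoots hr hα
  rw [h, hd] at this
  convert this using 1
  module

variable {e : realRoots A → Alg A}
  (he : ∀ α : realRoots A, IsRootVector A (α : I → ℤ) (e α))
include he

/-- No roots lie in between, and the root vectors commute because `α + β` has norm `4 + 2 α·β > 2`.
The empty formula therefore exists and is the only one. -/
lemma chevalleyRHS_eq_one {α β : realRoots A} (hd : 0 ≤ dot A α β) {R : Type v} [CommRing R]
    (t u : R) : chevalleyRHS e α β t u = {1} := by
  have hnone : ∀ γ : realRoots A, ¬ (γ ≠ α ∧ γ ≠ β ∧
      ∃ m n : ℕ, (γ : I → ℤ) = m • (α : I → ℤ) + n • (β : I → ℤ)) := by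
    rintro γ ⟨h₁, h₂, m, n, h⟩
    rcases combination_of_dot_nonneg hA hsl α.2 β.2 hd m n (h ▸ γ.2) with ⟨rfl, rfl⟩ | ⟨rfl, rfl⟩
    · exact h₁ (Subtype.ext (by simpa using h))
    · exact h₂ (Subtype.ext (by simpa using h))
  have hlie : ⁅e α, e β⁆ = 0 := by
    refine (he α).lie_eq_zero hA hsl (he β) ?_
    simp only [dot_add_left, dot_add_right, dot_self_of_mem_realRoots hA hsl α.2,
      dot_self_of_mem_realRoots hA hsl β.2, dot_comm (hA.symm_of_isSimplyLaced hsl) β α]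
    omega
  ext g
  rw [Set.mem_singleton_iff]
  constructor
  · rintro ⟨F, rfl⟩
    have : F.roots = [] := List.eq_nil_iff_forall_not_mem.mpr fun γ hγ =>
      hnone γ ((F.mem_roots γ).mp hγ)
    simp [CommutatorFormula.rhs, this]
  · rintro rfl
    let F : CommutatorFormula e α β :=
      { roots := []
        nodup := List.nodup_nil
        mem_roots := fun γ => by simpa using hnone γ
        m := 0
        n := 0
        expand := by simp
        c := 0
        formula := by simpa using expSeries_commutator_of_lie_eq_zero hlie }
    exact ⟨F, by simp [CommutatorFormula.rhs, F]⟩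

lemma exists_chevalleyRHS_eq {α β : realRoots A} (hd : dot A α β = -1)
    (h : (α : I → ℤ) + (β : I → ℤ) ∈ realRoots A) :
    ∃ ε : ℤ, (ε = 1 ∨ ε = -1) ∧ ∀ (R : Type v) [CommRing R] (t u : R),
      chevalleyRHS e α β t u = {X ⟨(α : I → ℤ) + (β : I → ℤ), h⟩ ((ε : R) * (t * u))} := by
  have hs := hA.symm_of_isSimplyLaced hsl
  have hα₂ := dot_self_of_mem_realRoots hA hsl α.2
  have hβ₂ := dot_self_of_mem_realRoots hA hsl β.2
  have hβα : dot A β α = -1 := by rw [dot_comm hs, hd]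
  set σ : realRoots A := ⟨(α : I → ℤ) + (β : I → ℤ), h⟩ with hσ
  have hσα : σ ≠ α := fun h' => by
    have hβ0 : (β : I → ℤ) = 0 := by simpa [hσ] using congrArg Subtype.val h'
    rw [hβ0] at hβ₂
    simp [dot] at hβ₂
  have hσβ : σ ≠ β := fun h' => by
    have hα0 : (α : I → ℤ) = 0 := by simpa [hσ] using congrArg Subtype.val h'
    rw [hα0] at hα₂
    simp [dot] at hα₂
  have hmem : ∀ γ : realRoots A, (γ ≠ α ∧ γ ≠ β ∧
      ∃ m n : ℕ, (γ : I → ℤ) = m • (α : I → ℤ) + n • (β : I → ℤ)) ↔ γ = σ := by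
    refine fun γ => ⟨?_, ?_⟩
    · rintro ⟨h₁, h₂, m, n, h'⟩
      rcases combination_of_dot_eq_neg_one hA hsl α.2 β.2 hd m n (h' ▸ γ.2) with
        ⟨rfl, rfl⟩ | ⟨rfl, rfl⟩ | ⟨rfl, rfl⟩
      · exact absurd (Subtype.ext (by simpa using h')) h₁
      · exact absurd (Subtype.ext (by simpa using h')) h₂
      · exact Subtype.ext (by simpa using h')
    · rintro rfl
      exact ⟨hσα, hσβ, 1, 1, by simp [hσ]⟩
  obtain ⟨ε, hε, hlie⟩ := (he α).lie_eq hA hsl (he β) (he σ) hd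
  have hσx : ⁅e σ, e α⁆ = 0 := by
    refine (he σ).lie_eq_zero hA hsl (he α) ?_
    simp only [hσ, dot_add_left, dot_add_right, hα₂, hβ₂, hd, hβα]
    norm_num
  have hσy : ⁅e σ, e β⁆ = 0 := by
    refine (he σ).lie_eq_zero hA hsl (he β) ?_
    simp only [hσ, dot_add_left, dot_add_right, hα₂, hβ₂, hd, hβα]
    norm_num
  have hformula := expSeries_commutator hlie hσx hσy
  refine ⟨ε, hε, fun R _ t u => ?_⟩
  ext g
  rw [Set.mem_singleton_iff]
  constructor
  · rintro ⟨F, rfl⟩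
    have hroots : F.roots = [σ] := by
      have hperm : F.roots.Perm [σ] := (List.perm_ext_iff_of_nodup F.nodup
        (List.nodup_singleton σ)).mpr fun γ => by
          rw [F.mem_roots, hmem, List.mem_singleton]
      exact List.perm_singleton.mp hperm
    have hexp := F.expand σ (by simp [hroots])
    -- The exponents in a formula are constrained only by the expansion of `σ`; any pair other than
    -- `(1, 1)` would make `σ` equal to `α` or `β`.
    have hmn : F.m σ = 1 ∧ F.n σ = 1 := by
      rcases combination_of_dot_eq_neg_one hA hsl α.2 β.2 hd _ _ (hexp ▸ σ.2) with
        ⟨h₁, h₂⟩ | ⟨h₁, h₂⟩ | h₁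
      · rw [h₁, h₂] at hexp
        exact absurd (Subtype.ext (by simpa using hexp)) hσα
      · rw [h₁, h₂] at hexp
        exact absurd (Subtype.ext (by simpa using hexp)) hσβ
      · exact h₁
    have hF := F.formula
    rw [hformula, hroots] at hF
    simp only [List.map_cons, List.map_nil, List.prod_singleton, hmn.1, hmn.2] at hF
    have hc := expSeries_one_one_injective ((he σ).ι_ne_zero hA hsl) hF
    simp [CommutatorFormula.rhs, hroots, hmn.1, hmn.2, ← hc, mul_assoc]
  · rintro rfl
    let F : CommutatorFormula e α β :=
      { roots := [σ]
        nodup := List.nodup_singleton σ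
        mem_roots := fun γ => by rw [hmem, List.mem_singleton]
        m := 1
        n := 1
        expand := fun γ hγ => by
          rw [List.mem_singleton] at hγ
          subst hγ
          simp [hσ]
        c := fun _ => ε
        formula := by simpa using hformula }
    exact ⟨F, by simp [CommutatorFormula.rhs, F, mul_assoc]⟩

omit hA hsl he in
lemma commutator_stX {α β : realRoots A} (hp : IsPrenilpotent A α β) {R : Type v} [CommRing R]
    {t u : R} {g : FreeProd A R} (hg : g ∈ chevalleyRHS e α β t u) :
    ⁅stX e α t, stX e β u⁆ = (QuotientGroup.mk g : Steinberg e R) := by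
  have : (QuotientGroup.mk (⁅X α t, X β u⁆ * g⁻¹) : Steinberg e R) = 1 :=
    (QuotientGroup.eq_one_iff _).mpr
      (Subgroup.subset_normalClosure ⟨α, β, hp, t, u, g, hg, rfl⟩)
  exact mul_inv_eq_one.mp this

end Chevalley

end KacMoody

end

theorem lemma2p1 {I : Type*} [Fintype I] [DecidableEq I] (A : Matrix I I ℤ)
    (hA : KacMoody.IsGCM A) (hsl : A.IsSimplyLaced) (hhyp : KacMoody.IsHyperbolic A)
    (e : KacMoody.realRoots A → KacMoody.Alg A)
    (he : ∀ α : KacMoody.realRoots A, KacMoody.IsRootVector A (α : I → ℤ) (e α))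
    (α β : KacMoody.realRoots A) (hαβ : α ≠ β) :
    (KacMoody.IsPrenilpotent A α β ↔ -1 ≤ KacMoody.dot A α β) ∧
    (KacMoody.IsPrenilpotent A α β →
      (KacMoody.dot A α β = -1 →
        ∃ h : (α : I → ℤ) + (β : I → ℤ) ∈ KacMoody.realRoots A,
        ∃ ε : ℤ, (ε = 1 ∨ ε = -1) ∧
          ∀ (R : Type*) [CommRing R] (t u : R),
            KacMoody.chevalleyRHS e α β t u =
              {KacMoody.X ⟨(α : I → ℤ) + (β : I → ℤ), h⟩ ((ε : R) * (t * u))} ∧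
            ⁅KacMoody.stX e α t, KacMoody.stX e β u⁆ =
              KacMoody.stX e ⟨(α : I → ℤ) + (β : I → ℤ), h⟩ ((ε : R) * (t * u))) ∧
      (KacMoody.dot A α β ≠ -1 →
          ∀ (R : Type*) [CommRing R] (t u : R),
            KacMoody.chevalleyRHS e α β t u = {1} ∧
            ⁅KacMoody.stX e α t, KacMoody.stX e β u⁆ = 1)) := by
  have hiff := KacMoody.isPrenilpotent_iff hA hsl hαβ
  refine ⟨hiff, fun hp => ⟨fun hd => ?_, fun hd R _ t u => ?_⟩⟩
  · have h := KacMoody.add_mem_realRoots hA hsl α.2 β.2 hd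
    obtain ⟨ε, hε, hR⟩ := KacMoody.exists_chevalleyRHS_eq hA hsl he hd h
    refine ⟨h, ε, hε, fun R _ t u => ⟨hR R t u, ?_⟩⟩
    exact KacMoody.commutator_stX hp (by rw [hR R t u]; exact Set.mem_singleton _)
  · have hd' : 0 ≤ KacMoody.dot A α β := by
      have := hiff.mp hp
      omega
    have h1 := KacMoody.chevalleyRHS_eq_one hA hsl he hd' t u
    exact ⟨h1, KacMoody.commutator_stX hp (by rw [h1]; exact Set.mem_singleton _)⟩
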